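/- We work in synthetic differential geometry, i.e. inside a topos (more generally, for spaces given as set-valued functors on a category of stages), all statements being read through generalized elements at an arbitrary stage. Let $R$ be the line: a commutative $\mathbb{Q}$-algebra object satisfying the general Kock–Lawvere axiom, that is, for every Weil algebra $W$ over $\mathbb{Q}$ the canonical map $W\otimes R\to R^{\operatorname{Spec}_R W}$ is an isomorphism. Put $D=\{d\in R\mid d^2=0\}$ and $D(2)=\{(d_1,d_2)\in D\times D\mid d_1d_2=0\}$. A space $M$ is microlinear if $W\mapsto M^{\operatorname{Spec}_R W}$ sends every finite limit diagram of Weil algebras to a limit diagram. A Lie group is a group object which is microlinear as a space. The Lie algebra $\mathfrak g$ of a Lie group $G$ is the space of maps $X:D\to G$ with $X(0)=1$. Here $(rX)(d)=X(rd)$ for $r\in R$; $(X+Y)(d)=\ell(d,d)$, where $\ell:D(2)\to G$ is the unique map with $\ell(d,0)=X(d)$ and $\ell(0,d)=Y(d)$; $X-Y=X+(-1)Y$; and $[X,Y]$ is the unique element of $\mathfrak g$ with $[X,Y](d_1d_2)=X(d_1)\,Y(d_2)\,X(d_1)^{-1}\,Y(d_2)^{-1}$ for all $d_1,d_2\in D$.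 The Lie group $G$ is regular if for every map $\xi:R\to\mathfrak g$ there is a unique map $\theta:R\to G$ with $\theta(0)=1$ and $\theta(t)^{-1}\theta(t+d)=\xi(t)(d)$ for all $t\in R$, $d\in D$. In that case $\exp:\mathfrak g\to G$ is defined by $\exp X=\theta(1)$, where $\theta$ belongs to the constant map $\xi=X$. **Theorem 4.3.** Let $G$ be a regular Lie group with Lie algebra $\mathfrak g$, let $d_1,d_2,d_3\in D$, let $X_1,X_2,X_3,Y_1,Y_2,Y_3\in\mathfrak g$, and write $\delta=d_1+d_2+d_3$. Then $$\exp\Big(\delta X_1+\tfrac12\delta^2X_2+\tfrac16\delta^3X_3\Big)\cdot\exp\Big(\delta Y_1+\tfrac12\delta^2Y_2+\tfrac16\delta^3Y_3\Big)$$ $$=\exp\Big(\delta(X_1+Y_1)+\tfrac12\delta^2\big(X_2+Y_2+[X_1,Y_1]\big)+\tfrac16\delta^3\big\{X_3+Y_3+\tfrac32\big([X_1,Y_2]+[X_2,Y_1]\big)+\tfrac12\,[X_1-Y_1,[X_1,Y_1]]\big\}\Big).$$ -/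

import Mathlib

open CategoryTheory

universe u v w w'

/-!
Synthetic differential geometry, read through generalized elements (Kripke-Joyal semantics).

The statements of synthetic differential geometry are not about sets (the Kock-Lawvere axiom is
incompatible with classical logic) but about the objects of a topos, and they are read through
generalized elements.  We take an arbitrary category `𝒮` of stages of definition, an arrow `A ⟶ B`
meaning that `B` is a later stage than `A`.  A space is a functor `X : 𝒮 ⥤ Type _`: its elements
at the stage `A` are the elements of `X.obj A`, and `X.map f` restricts elements to later stages.
A universal quantifier at the stage `A` ranges over all elements at all later stages.

This covers every topos model `𝓔`: take `𝒮 = 𝓔ᵒᵖ` and identify an object `X` with the functor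
`T ↦ (T ⟶ X)` of its generalized elements (for sheaves on a site, `𝒮` can also be the opposite
of the site).  These identifications preserve finite limits and exponentials, the only
constructions used below.
-/

namespace SDG

variable {𝒮 : Type u} [Category.{v} 𝒮]

/-- An element of the exponential `X ^ U` at the stage `A`: a map `U → X` given at the stage `A`,
that is, a family of maps from the elements of `U` to the elements of `X` at all stages later
than `A`, compatible with restriction.  (By Yoneda this is the same as a map `A × U → X`.) -/
@[ext]
structure Fn (U : 𝒮 ⥤ Type w) (X : 𝒮 ⥤ Type w') (A : 𝒮) where
  /-- The value at an element of `U` at a later stage. -/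
  toFun : ∀ {B : 𝒮}, (A ⟶ B) → U.obj B → X.obj B
  /-- Compatibility with restriction. -/
  naturality : ∀ {B C : 𝒮} (f : A ⟶ B) (g : B ⟶ C) (x : U.obj B),
    X.map g (toFun f x) = toFun (f ≫ g) (U.map g x)

/-- Restriction of a map to a later stage. -/
def Fn.restrict {U : 𝒮 ⥤ Type w} {X : 𝒮 ⥤ Type w'} {A B : 𝒮} (f : A ⟶ B) (φ : Fn U X A) :
    Fn U X B where
  toFun g x := φ.toFun (f ≫ g) x
  naturality g h x := by simpa using φ.naturality (f ≫ g) h x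

/-- The map `X ^ U → X ^ V` induced by `V → U`. -/
def Fn.comp {U V : 𝒮 ⥤ Type w} {X : 𝒮 ⥤ Type w'} {A : 𝒮} (φ : Fn U X A) (h : V ⟶ U) :
    Fn V X A where
  toFun f x := φ.toFun f (h.app _ x)
  naturality f g x := by
    rw [φ.naturality]
    congr 1
    exact (NatTrans.naturality_apply h g x).symm

/-! ### The line, infinitesimal objects and the Kock-Lawvere axiom -/

/-- A Weil algebra over `ℚ`: a finite-dimensional commutative algebra of the form `ℚ ⊕ I`
with `I` a nilpotent ideal (in finite dimension: all of its elements are nilpotent). -/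
def IsWeilAlgebra (W : Type) [CommRing W] [Algebra ℚ W] : Prop :=
  Module.Finite ℚ W ∧ ∃ π : W →ₐ[ℚ] ℚ, ∀ x : W, π x = 0 → IsNilpotent x

section Line

/- The line: a commutative ring object which is a `ℚ`-algebra. -/
variable (R : 𝒮 ⥤ CommAlgCat.{w} ℚ)

/-- The line as a mere space. -/
abbrev Line : 𝒮 ⥤ Type w := R ⋙ forget (CommAlgCat.{w} ℚ)

/-- The infinitesimal object `Spec_R W` of an algebra `W`: its elements at the stage `A` are the
algebra homomorphisms from `W` to the ring of elements of the line at the stage `A`. -/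
def Spec (W : Type) [CommRing W] [Algebra ℚ W] : 𝒮 ⥤ Type w where
  obj A := W →ₐ[ℚ] R.obj A
  map f := ↾(fun p => (R.map f).hom.comp p)
  map_id A := by ext p; simp
  map_comp f g := by ext p; simp [AlgHom.comp_assoc]

/-- The map `Spec_R W' → Spec_R W` induced by an algebra homomorphism `W → W'`. -/
def Spec.map {W W' : Type} [CommRing W] [Algebra ℚ W] [CommRing W'] [Algebra ℚ W']
    (h : W →ₐ[ℚ] W') : Spec R W' ⟶ Spec R W where
  app A := ↾(fun p : W' →ₐ[ℚ] R.obj A => p.comp h)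
  naturality A B f := by ext p; rfl

/-- The canonical map `W ⊗ R → R ^ (Spec_R W)` at the stage `A`; it sends `w ⊗ r` to the function
`p ↦ p(w) r`. -/
noncomputable def kockMap (W : Type) [CommRing W] [Algebra ℚ W] (A : 𝒮)
    (z : TensorProduct ℚ W (R.obj A)) : Fn (Spec R W) (Line R) A where
  toFun {B} f p := (Algebra.TensorProduct.productMap
    (show W →ₐ[ℚ] R.obj B from p) (R.map f).hom z : R.obj B)
  naturality {B C} f g p := by
    change (R.map g).hom (Algebra.TensorProduct.productMap
      (show W →ₐ[ℚ] R.obj B from p) (R.map f).hom z) = _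
    induction z using TensorProduct.induction_on with
    | zero => simp
    | tmul x y =>
      rw [Algebra.TensorProduct.productMap_apply_tmul, map_mul,
        Algebra.TensorProduct.productMap_apply_tmul, Functor.map_comp]
      rfl
    | add x y hx hy => simp only [map_add, hx, hy]

/-- The (general) Kock-Lawvere axiom: for every Weil algebra `W`, the canonical map
`W ⊗ R → R ^ (Spec_R W)` is an isomorphism. -/
def KockLawvere : Prop :=
  ∀ (W : Type) [CommRing W] [Algebra ℚ W], IsWeilAlgebra W →
    ∀ A : 𝒮, Function.Bijective (kockMap R W A)

/-- A space `X` is microlinear if every finite diagram of Weil algebras together with a limit cone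
(in the category of algebras) whose vertex is a Weil algebra is turned into a limit diagram by
`W ↦ X ^ (Spec_R W)`. -/
def IsMicrolinear (X : 𝒮 ⥤ Type w') : Prop :=
  ∀ (J : Type) [SmallCategory J] [FinCategory J] (F : J ⥤ CommAlgCat.{0} ℚ) (c : Limits.Cone F),
    (∀ j, IsWeilAlgebra (F.obj j)) → IsWeilAlgebra c.pt → Nonempty (Limits.IsLimit c) →
    ∀ (A : 𝒮) (φ : ∀ j, Fn (Spec R (F.obj j)) X A),
      (∀ {i j : J} (h : i ⟶ j), (φ i).comp (Spec.map R (F.map h).hom) = φ j) →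
      ∃! ψ : Fn (Spec R c.pt) X A, ∀ j, ψ.comp (Spec.map R (c.π.app j).hom) = φ j

/-- `D`, the elements of square zero of the line. -/
def D : 𝒮 ⥤ Type w where
  obj A := {d : R.obj A // d ^ 2 = 0}
  map f := ↾(fun d => ⟨(R.map f).hom d.1, by rw [← map_pow, d.2, map_zero]⟩)
  map_id A := by ext d; simp
  map_comp f g := by ext d; simp

/-- `D(2)`, the pairs of elements of the line all of whose products vanish. -/
def D2 : 𝒮 ⥤ Type w where
  obj A := {d : R.obj A × R.obj A // d.1 ^ 2 = 0 ∧ d.2 ^ 2 = 0 ∧ d.1 * d.2 = 0}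
  map f := ↾(fun d => ⟨((R.map f).hom d.1.1, (R.map f).hom d.1.2), by
    refine ⟨?_, ?_, ?_⟩
    · rw [← map_pow, d.2.1, map_zero]
    · rw [← map_pow, d.2.2.1, map_zero]
    · rw [← map_mul, d.2.2.2, map_zero]⟩)
  map_id A := by ext d <;> simp
  map_comp f g := by ext d <;> simp

/-- The first axis `d ↦ (d, 0)` of `D(2)`. -/
def axis₁ : D R ⟶ D2 R where
  app A := ↾(fun d => ⟨(d.1, 0), d.2, by simp, by simp⟩)
  naturality A B f := by ext d; exact Subtype.ext (Prod.ext rfl (map_zero (R.map f).hom).symm)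

/-- The second axis `d ↦ (0, d)` of `D(2)`. -/
def axis₂ : D R ⟶ D2 R where
  app A := ↾(fun d => ⟨(0, d.1), by simp, d.2, by simp⟩)
  naturality A B f := by ext d; exact Subtype.ext (Prod.ext (map_zero (R.map f).hom).symm rfl)

/-- The diagonal `d ↦ (d, d)` of `D(2)`. -/
def diag : D R ⟶ D2 R where
  app A := ↾(fun d => ⟨(d.1, d.1), d.2, d.2, by rw [← pow_two, d.2]⟩)
  naturality A B f := by ext d; exact Subtype.ext (Prod.ext rfl rfl)

end Line

/-- The point `0` of `D`. -/
def D.zero {R : 𝒮 ⥤ CommAlgCat.{w} ℚ} (A : 𝒮) : (D R).obj A :=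
  (⟨0, by simp⟩ : {d : R.obj A // d ^ 2 = 0})

/-- The multiple `r d` of an element `d` of `D` by an element `r` of the line. -/
def D.scale {R : 𝒮 ⥤ CommAlgCat.{w} ℚ} {A : 𝒮} (r : R.obj A) (d : (D R).obj A) : (D R).obj A :=
  (⟨r * d.1, by rw [mul_pow, d.2, mul_zero]⟩ : {d : R.obj A // d ^ 2 = 0})

/-! ### Helper facts on microlinear spaces

The two quasi-colimits behind the sum and the bracket of tangent vectors:
`D(2)` is the union of its two axes, and `D` is the quotient of `D × D` by `D(2)`. -/

theorem isLimit_of_pullback {W₀ W₁ W₂ W₃ : Type} [CommRing W₀] [Algebra ℚ W₀] [CommRing W₁]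
    [Algebra ℚ W₁] [CommRing W₂] [Algebra ℚ W₂] [CommRing W₃] [Algebra ℚ W₃]
    (f₁ : W₁ →ₐ[ℚ] W₀) (f₂ : W₂ →ₐ[ℚ] W₀) (p₁ : W₃ →ₐ[ℚ] W₁) (p₂ : W₃ →ₐ[ℚ] W₂)
    (hc : f₁.comp p₁ = f₂.comp p₂)
    (h : ∀ a b, f₁ a = f₂ b → ∃! x, p₁ x = a ∧ p₂ x = b) :
    Nonempty (Limits.IsLimit (Limits.PullbackCone.mk (f := CommAlgCat.ofHom f₁)
      (g := CommAlgCat.ofHom f₂) (CommAlgCat.ofHom p₁) (CommAlgCat.ofHom p₂)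
      (by rw [← CommAlgCat.ofHom_comp, hc, CommAlgCat.ofHom_comp]))) := by
  have key : ∀ (T : CommAlgCat.{0} ℚ) (g₁ : T →ₐ[ℚ] W₁) (g₂ : T →ₐ[ℚ] W₂),
      f₁.comp g₁ = f₂.comp g₂ → ∃ l : T →ₐ[ℚ] W₃, p₁.comp l = g₁ ∧ p₂.comp l = g₂ := by
    intro T g₁ g₂ hg
    have e : ∀ t, ∃! x, p₁ x = g₁ t ∧ p₂ x = g₂ t := fun t =>
      h _ _ (DFunLike.congr_fun hg t)
    choose l hl using fun t => (e t).exists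
    have hu : ∀ t y, p₁ y = g₁ t → p₂ y = g₂ t → l t = y := fun t y h1 h2 =>
      (e t).unique (hl t) ⟨h1, h2⟩
    refine ⟨{ toFun := l, map_one' := ?_, map_mul' := ?_, map_zero' := ?_, map_add' := ?_,
              commutes' := ?_ }, ?_, ?_⟩
    · apply hu <;> simp
    · intro x y; apply hu <;> simp [hl]
    · apply hu <;> simp
    · intro x y; apply hu <;> simp [hl]
    · intro r; apply hu <;> simp
    · ext t; exact (hl t).1
    · ext t; exact (hl t).2
  have key' : ∀ s : Limits.PullbackCone (CommAlgCat.ofHom f₁) (CommAlgCat.ofHom f₂),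
      ∃ l : s.pt →ₐ[ℚ] W₃, p₁.comp l = s.fst.hom ∧ p₂.comp l = s.snd.hom := fun s =>
    key s.pt s.fst.hom s.snd.hom (congrArg CommAlgCat.Hom.hom s.condition)
  choose l hl using key'
  refine ⟨Limits.PullbackCone.IsLimit.mk _ (fun s => CommAlgCat.ofHom (l s)) ?_ ?_ ?_⟩
  · intro s; ext x; exact DFunLike.congr_fun (hl s).1 x
  · intro s; ext x; exact DFunLike.congr_fun (hl s).2 x
  · intro s m h1 h2
    ext x
    have a1 : p₁ (m.hom x) = s.fst.hom x := by rw [← h1]; rfl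
    have a2 : p₂ (m.hom x) = s.snd.hom x := by rw [← h2]; rfl
    have b1 : p₁ (l s x) = s.fst.hom x := DFunLike.congr_fun (hl s).1 x
    have b2 : p₂ (l s x) = s.snd.hom x := DFunLike.congr_fun (hl s).2 x
    refine (h (s.fst.hom x) (s.snd.hom x) ?_).unique ⟨a1, a2⟩ ⟨b1, b2⟩
    exact DFunLike.congr_fun (congrArg CommAlgCat.Hom.hom s.condition) x

theorem IsMicrolinear.pullback {R : 𝒮 ⥤ CommAlgCat.{w} ℚ} {X : 𝒮 ⥤ Type w'}
    (hX : IsMicrolinear R X) {W₀ W₁ W₂ W₃ : Type} [CommRing W₀] [Algebra ℚ W₀] [CommRing W₁]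
    [Algebra ℚ W₁] [CommRing W₂] [Algebra ℚ W₂] [CommRing W₃] [Algebra ℚ W₃]
    (h₀ : IsWeilAlgebra W₀) (h₁ : IsWeilAlgebra W₁) (h₂ : IsWeilAlgebra W₂)
    (h₃ : IsWeilAlgebra W₃)
    (f₁ : W₁ →ₐ[ℚ] W₀) (f₂ : W₂ →ₐ[ℚ] W₀) (p₁ : W₃ →ₐ[ℚ] W₁) (p₂ : W₃ →ₐ[ℚ] W₂)
    (hc : f₁.comp p₁ = f₂.comp p₂)
    (h : ∀ a b, f₁ a = f₂ b → ∃! x, p₁ x = a ∧ p₂ x = b)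
    {A : 𝒮} (φ₁ : Fn (Spec R W₁) X A) (φ₂ : Fn (Spec R W₂) X A)
    (hφ : φ₁.comp (Spec.map R f₁) = φ₂.comp (Spec.map R f₂)) :
    ∃! ψ : Fn (Spec R W₃) X A, ψ.comp (Spec.map R p₁) = φ₁ ∧ ψ.comp (Spec.map R p₂) = φ₂ := by
  have := hX Limits.WalkingCospan (Limits.cospan (CommAlgCat.ofHom f₁) (CommAlgCat.ofHom f₂)) _
    (by rintro (_ | _ | _) <;> assumption) h₃ (isLimit_of_pullback f₁ f₂ p₁ p₂ hc h) A
    (fun j => match j with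
      | none => φ₁.comp (Spec.map R f₁)
      | some .left => φ₁
      | some .right => φ₂)
    (by
      rintro _ _ (_ | _ | _)
      · rename_i i
        rcases i with (_ | _ | _) <;> rfl
      · rfl
      · exact hφ.symm)
  obtain ⟨ψ, h1, h2⟩ := this
  refine ⟨ψ, ⟨h1 (some .left), h1 (some .right)⟩, ?_⟩
  rintro ψ' ⟨h3, h4⟩
  apply h2
  rintro (_ | _ | _)
  · change ψ'.comp (Spec.map R (f₁.comp p₁)) = φ₁.comp (Spec.map R f₁)
    rw [← h3]; rfl
  · exact h3
  · exact h4

/-! #### The Weil algebras of `D`, `D(2)` and `D × D` -/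

/-- The Weil algebra of `D`. -/
abbrev WD : Type := DualNumber ℚ
/-- The Weil algebra of `D(2)`. -/
abbrev WD2 : Type := TrivSqZeroExt ℚ (ℚ × ℚ)
/-- The Weil algebra of `D × D`. -/
abbrev WDD : Type := DualNumber (DualNumber ℚ)

theorem isWeilAlgebra_rat : IsWeilAlgebra ℚ :=
  ⟨inferInstance, AlgHom.id ℚ ℚ, fun x hx => by
    have : x = 0 := hx
    rw [this]; exact IsNilpotent.zero⟩

theorem isWeilAlgebra_WD : IsWeilAlgebra WD := by
  refine ⟨Module.Finite.equiv (show (ℚ × ℚ) ≃ₗ[ℚ] WD from LinearEquiv.refl ℚ (ℚ × ℚ)),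
    TrivSqZeroExt.fstHom ℚ ℚ ℚ, fun x hx => ⟨2, ?_⟩⟩
  have h : x.fst = 0 := hx
  ext <;> simp [pow_two, h]

theorem isWeilAlgebra_WD2 : IsWeilAlgebra WD2 := by
  refine ⟨Module.Finite.equiv (show (ℚ × (ℚ × ℚ)) ≃ₗ[ℚ] WD2 from LinearEquiv.refl ℚ _),
    TrivSqZeroExt.fstHom ℚ ℚ (ℚ × ℚ), fun x hx => ⟨2, ?_⟩⟩
  have h : x.fst = 0 := hx
  ext <;> simp [pow_two, h]

theorem isWeilAlgebra_WDD : IsWeilAlgebra WDD := by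
  refine ⟨Module.Finite.equiv (show ((ℚ × ℚ) × (ℚ × ℚ)) ≃ₗ[ℚ] WDD from LinearEquiv.refl ℚ _),
    (TrivSqZeroExt.fstHom ℚ ℚ ℚ).comp (TrivSqZeroExt.fstHom ℚ WD WD), fun x hx => ⟨3, ?_⟩⟩
  have h : x.fst.fst = 0 := hx
  apply TrivSqZeroExt.ext <;> apply TrivSqZeroExt.ext <;> simp [pow_succ, h]

section lifts
variable {B : Type w} [CommRing B] [Algebra ℚ B]

/-- The homomorphism `ε ↦ d`. -/
def liftD (d : B) (hd : d ^ 2 = 0) : WD →ₐ[ℚ] B :=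
  DualNumber.lift ⟨(Algebra.ofId ℚ B, d), by rw [← pow_two, hd], fun _ => Commute.all _ _⟩

/-- The homomorphism `ε₁ ↦ d₁`, `ε₂ ↦ d₂`, if all products of `d₁`, `d₂` vanish. -/
def liftD2 (d₁ d₂ : B) (h₁ : d₁ ^ 2 = 0) (h₂ : d₂ ^ 2 = 0) (h : d₁ * d₂ = 0) : WD2 →ₐ[ℚ] B :=
  TrivSqZeroExt.liftEquivOfComm ⟨LinearMap.coprod (LinearMap.toSpanSingleton ℚ B d₁)
    (LinearMap.toSpanSingleton ℚ B d₂), by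
      intro x y
      have h' : d₂ * d₁ = 0 := by rw [mul_comm, h]
      rw [pow_two] at h₁ h₂
      simp [mul_add, add_mul, h, h', h₁, h₂]⟩

/-- The homomorphism `ε₁ ↦ d₁`, `ε₂ ↦ d₂`. -/
def liftDD (d₁ d₂ : B) (h₁ : d₁ ^ 2 = 0) (h₂ : d₂ ^ 2 = 0) : WDD →ₐ[ℚ] B :=
  DualNumber.lift ⟨(liftD d₁ h₁, d₂), by rw [← pow_two, h₂], fun _ => Commute.all _ _⟩

theorem liftD_apply (d : B) (hd : d ^ 2 = 0) (x : WD) :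
    liftD d hd x = algebraMap ℚ B x.fst + algebraMap ℚ B x.snd * d := rfl

theorem liftD2_apply (d₁ d₂ : B) (h₁ : d₁ ^ 2 = 0) (h₂ : d₂ ^ 2 = 0) (h : d₁ * d₂ = 0) (x : WD2) :
    liftD2 d₁ d₂ h₁ h₂ h x = algebraMap ℚ B x.fst + (x.snd.1 • d₁ + x.snd.2 • d₂) := rfl

theorem liftDD_apply (d₁ d₂ : B) (h₁ : d₁ ^ 2 = 0) (h₂ : d₂ ^ 2 = 0) (x : WDD) :
    liftDD d₁ d₂ h₁ h₂ x = (algebraMap ℚ B x.fst.fst + algebraMap ℚ B x.fst.snd * d₁) +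
      (algebraMap ℚ B x.snd.fst + algebraMap ℚ B x.snd.snd * d₁) * d₂ := rfl

end lifts

/-- The generator of `WD`. -/
abbrev eps : WD := DualNumber.eps
/-- The first generator of `WD2`. -/
abbrev eps₁ : WD2 := TrivSqZeroExt.inr (1, 0)
/-- The second generator of `WD2`. -/
abbrev eps₂ : WD2 := TrivSqZeroExt.inr (0, 1)
/-- The first generator of `WDD`. -/
abbrev del₁ : WDD := TrivSqZeroExt.inl DualNumber.eps
/-- The second generator of `WDD`. -/
abbrev del₂ : WDD := DualNumber.eps

theorem eps_sq : eps ^ 2 = 0 := by rw [pow_two]; exact DualNumber.eps_mul_eps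
theorem eps₁_sq : eps₁ ^ 2 = 0 := by rw [pow_two]; exact TrivSqZeroExt.inr_mul_inr ..
theorem eps₂_sq : eps₂ ^ 2 = 0 := by rw [pow_two]; exact TrivSqZeroExt.inr_mul_inr ..
theorem eps₁_mul_eps₂ : eps₁ * eps₂ = 0 := TrivSqZeroExt.inr_mul_inr ..
theorem del₁_sq : del₁ ^ 2 = 0 := by
  rw [pow_two, ← TrivSqZeroExt.inl_mul, DualNumber.eps_mul_eps, TrivSqZeroExt.inl_zero]
theorem del₂_sq : del₂ ^ 2 = 0 := by rw [pow_two]; exact DualNumber.eps_mul_eps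
theorem del_sq : (del₁ * del₂) ^ 2 = 0 :=
  (mul_pow del₁ del₂ 2).trans (by rw [del₁_sq, zero_mul])

theorem hom_sq {W B : Type*} [CommRing W] [Algebra ℚ W] [CommRing B] [Algebra ℚ B]
    (p : W →ₐ[ℚ] B) {x : W} (hx : x ^ 2 = 0) : p x ^ 2 = 0 := by rw [← map_pow, hx, map_zero]

section helpers

variable {R : 𝒮 ⥤ CommAlgCat.{w} ℚ}

/-- An element of square zero in a Weil algebra `W` defines a map `Spec_R W → D`. -/
def toD {W : Type} [CommRing W] [Algebra ℚ W] (x : W) (hx : x ^ 2 = 0) : Spec R W ⟶ D R where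
  app A := ↾(fun p : W →ₐ[ℚ] R.obj A => ⟨p x, hom_sq p hx⟩)
  naturality A B f := by ext p; rfl

/-- The comparison map `Spec_R (WD2) → D(2)`. -/
def toD2 : Spec R WD2 ⟶ D2 R where
  app A := ↾(fun p : WD2 →ₐ[ℚ] R.obj A => ⟨(p eps₁, p eps₂), hom_sq p eps₁_sq, hom_sq p eps₂_sq,
    by rw [← map_mul, eps₁_mul_eps₂, map_zero]⟩)
  naturality A B f := by ext p; rfl

/-- The comparison map `D → Spec_R (WD)`. -/
def ofD : D R ⟶ Spec R WD where
  app A := ↾(fun d => liftD d.1 d.2)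
  naturality A B f := by
    ext d
    refine DualNumber.algHom_ext ?_
    change liftD ((R.map f).hom d.1) (hom_sq _ d.2) eps = (R.map f).hom (liftD d.1 d.2 eps)
    simp [liftD_apply]

theorem Fn.comp_injective {U V : 𝒮 ⥤ Type w} {X : 𝒮 ⥤ Type w'} {A : 𝒮} {φ ψ : Fn U X A}
    (h : V ⟶ U) (hs : ∀ B, Function.Surjective (h.app B)) (e : φ.comp h = ψ.comp h) : φ = ψ := by
  ext B f x
  obtain ⟨y, rfl⟩ := hs B x
  exact congrArg (fun χ : Fn V X A => χ.toFun f y) e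

theorem toD2_surjective (B : 𝒮) : Function.Surjective ((toD2 (R := R)).app B) := by
  rintro ⟨⟨a, b⟩, h1, h2, h⟩
  refine ⟨liftD2 a b h1 h2 h, Subtype.ext (Prod.ext ?_ ?_)⟩
  · change liftD2 a b h1 h2 h eps₁ = a
    simp [liftD2_apply]
  · change liftD2 a b h1 h2 h eps₂ = b
    simp [liftD2_apply]

theorem toD_surjective (B : 𝒮) : Function.Surjective ((toD (R := R) eps eps_sq).app B) := by
  rintro ⟨a, h⟩
  refine ⟨liftD a h, Subtype.ext ?_⟩
  change liftD a h eps = a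
  simp [liftD_apply]

theorem toD_eps_ofD : toD (R := R) eps eps_sq ≫ ofD = 𝟙 _ := by
  ext A p
  refine DualNumber.algHom_ext ?_
  change liftD ((show WD →ₐ[ℚ] R.obj A from p) eps) (hom_sq _ eps_sq) eps =
    (show WD →ₐ[ℚ] R.obj A from p) eps
  simp [liftD_apply]

/-- A function on `D(2)` with values in a microlinear space is determined by its restrictions to
the axes. -/
theorem IsMicrolinear.ext_D2 {X : 𝒮 ⥤ Type w'} (hX : IsMicrolinear R X) {A : 𝒮}
    {ℓ ℓ' : Fn (D2 R) X A} (h₁ : ℓ.comp (axis₁ R) = ℓ'.comp (axis₁ R))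
    (h₂ : ℓ.comp (axis₂ R) = ℓ'.comp (axis₂ R)) : ℓ = ℓ' := by
  let p₁ : WD2 →ₐ[ℚ] WD := liftD2 eps 0 eps_sq (by simp) (by simp)
  let p₂ : WD2 →ₐ[ℚ] WD := liftD2 0 eps (by simp) eps_sq (by simp)
  let f : WD →ₐ[ℚ] ℚ := liftD 0 (by simp)
  have e₁ : Spec.map R p₁ ≫ toD2 = toD eps eps_sq ≫ axis₁ R := by
    ext A p
    refine Subtype.ext (Prod.ext ?_ ?_)
    · change (show WD →ₐ[ℚ] R.obj A from p) (p₁ eps₁) = (show WD →ₐ[ℚ] R.obj A from p) eps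
      congr 1
      simp [p₁, liftD2_apply]
    · change (show WD →ₐ[ℚ] R.obj A from p) (p₁ eps₂) = 0
      rw [show p₁ eps₂ = 0 by simp [p₁, liftD2_apply]]
      exact map_zero (show WD →ₐ[ℚ] R.obj A from p)
  have e₂ : Spec.map R p₂ ≫ toD2 = toD eps eps_sq ≫ axis₂ R := by
    ext A p
    refine Subtype.ext (Prod.ext ?_ ?_)
    · change (show WD →ₐ[ℚ] R.obj A from p) (p₂ eps₁) = 0
      rw [show p₂ eps₁ = 0 by simp [p₂, liftD2_apply]]
      exact map_zero (show WD →ₐ[ℚ] R.obj A from p)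
    · change (show WD →ₐ[ℚ] R.obj A from p) (p₂ eps₂) = (show WD →ₐ[ℚ] R.obj A from p) eps
      congr 1
      simp [p₂, liftD2_apply]
  have hc : f.comp p₁ = f.comp p₂ := by
    refine TrivSqZeroExt.algHom_ext fun m => ?_
    simp [f, p₁, p₂, liftD_apply, liftD2_apply]
  have hu := hX.pullback isWeilAlgebra_rat isWeilAlgebra_WD isWeilAlgebra_WD isWeilAlgebra_WD2
    f f p₁ p₂ hc (by
      intro a b hab
      have hab' : a.fst = b.fst := by simpa [f, liftD_apply] using hab
      refine ⟨(TrivSqZeroExt.inl a.fst + TrivSqZeroExt.inr (a.snd, b.snd) : WD2), ⟨?_, ?_⟩, ?_⟩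
      · ext <;> simp [p₁, liftD2_apply, TrivSqZeroExt.algebraMap_eq_inl]
      · ext <;> simp [p₂, liftD2_apply, TrivSqZeroExt.algebraMap_eq_inl, hab']
      · rintro x ⟨rfl, rfl⟩
        ext <;> simp [p₁, p₂, liftD2_apply, TrivSqZeroExt.algebraMap_eq_inl])
    ((ℓ.comp toD2).comp (Spec.map R p₁)) ((ℓ.comp toD2).comp (Spec.map R p₂))
    (by
      change (ℓ.comp toD2).comp (Spec.map R (f.comp p₁)) =
        (ℓ.comp toD2).comp (Spec.map R (f.comp p₂))
      rw [hc])
  refine Fn.comp_injective toD2 toD2_surjective (hu.unique ⟨rfl, rfl⟩ ⟨?_, ?_⟩)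
  · change ℓ'.comp (Spec.map R p₁ ≫ toD2) = ℓ.comp (Spec.map R p₁ ≫ toD2)
    rw [e₁]
    exact congrArg (fun χ => χ.comp (toD eps eps_sq)) h₁.symm
  · change ℓ'.comp (Spec.map R p₂ ≫ toD2) = ℓ.comp (Spec.map R p₂ ≫ toD2)
    rw [e₂]
    exact congrArg (fun χ => χ.comp (toD eps eps_sq)) h₂.symm

theorem IsMicrolinear.factor_aux {X : 𝒮 ⥤ Type w'} (hX : IsMicrolinear R X) {A : 𝒮}
    (τ : Fn (Spec R WDD) X A) (x₀ : Fn (Spec R ℚ) X A)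
    (h : τ.comp (Spec.map R (liftDD eps₁ eps₂ eps₁_sq eps₂_sq)) =
      x₀.comp (Spec.map R (Algebra.ofId ℚ WD2))) :
    ∃! ψ : Fn (D R) X A, ψ.comp (toD (del₁ * del₂) del_sq) = τ ∧
      ψ.comp (toD 0 (by simp)) = x₀ := by
  let f₁ : WDD →ₐ[ℚ] WD2 := liftDD eps₁ eps₂ eps₁_sq eps₂_sq
  let p₁ : WD →ₐ[ℚ] WDD := liftD (del₁ * del₂) del_sq
  let p₂ : WD →ₐ[ℚ] ℚ := liftD 0 (by simp)
  have hc : f₁.comp p₁ = (Algebra.ofId ℚ WD2).comp p₂ := by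
    refine DualNumber.algHom_ext ?_
    simp [f₁, p₁, p₂, liftD_apply, liftDD_apply, Algebra.ofId_apply]
  have e₁ : Spec.map R p₁ ≫ toD eps eps_sq = toD (del₁ * del₂) del_sq := by
    ext A p
    refine Subtype.ext ?_
    change (show WDD →ₐ[ℚ] R.obj A from p) (p₁ eps) = (show WDD →ₐ[ℚ] R.obj A from p) _
    congr 1
    simp [p₁, liftD_apply]
  have e₂ : Spec.map R p₂ ≫ toD eps eps_sq = toD 0 (by simp) := by
    ext A p
    refine Subtype.ext ?_
    change (show ℚ →ₐ[ℚ] R.obj A from p) (p₂ eps) = (show ℚ →ₐ[ℚ] R.obj A from p) _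
    congr 1
    simp [p₂, liftD_apply]
  obtain ⟨ψ, ⟨h1, h2⟩, hu⟩ := hX.pullback isWeilAlgebra_WD2 isWeilAlgebra_WDD isWeilAlgebra_rat
    isWeilAlgebra_WD f₁ (Algebra.ofId ℚ WD2) p₁ p₂ hc (by
      intro a b hab
      have i1 : a.fst.fst = b := by
        simpa [f₁, liftDD_apply, Algebra.ofId_apply, TrivSqZeroExt.algebraMap_eq_inl]
          using congrArg TrivSqZeroExt.fst hab
      have i2 : a.fst.snd = 0 := by
        simpa [f₁, liftDD_apply, Algebra.ofId_apply, TrivSqZeroExt.algebraMap_eq_inl]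
          using congrArg (fun z => z.snd.1) hab
      have i3 : a.snd.fst = 0 := by
        simpa [f₁, liftDD_apply, Algebra.ofId_apply, TrivSqZeroExt.algebraMap_eq_inl]
          using congrArg (fun z => z.snd.2) hab
      refine ⟨(TrivSqZeroExt.inl b + TrivSqZeroExt.inr a.snd.snd : WD), ⟨?_, ?_⟩, ?_⟩
      · apply TrivSqZeroExt.ext <;> apply TrivSqZeroExt.ext <;>
          simp [p₁, liftD_apply, TrivSqZeroExt.algebraMap_eq_inl', i1, i2, i3]
      · simp [p₂, liftD_apply]
      · rintro x ⟨rfl, rfl⟩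
        ext <;> simp [p₁, p₂, liftD_apply, TrivSqZeroExt.algebraMap_eq_inl'])
    τ x₀ h
  refine ⟨ψ.comp ofD, ⟨?_, ?_⟩, ?_⟩
  · change ψ.comp (toD (del₁ * del₂) del_sq ≫ ofD) = τ
    rw [← e₁, Category.assoc, toD_eps_ofD, Category.comp_id, h1]
  · change ψ.comp (toD 0 _ ≫ ofD) = x₀
    rw [← e₂, Category.assoc, toD_eps_ofD, Category.comp_id, h2]
  · rintro χ ⟨h3, h4⟩
    refine Fn.comp_injective (toD eps eps_sq) toD_surjective ?_
    change _ = ψ.comp (toD eps eps_sq ≫ ofD)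
    rw [toD_eps_ofD]
    refine hu _ ⟨?_, ?_⟩
    · change χ.comp (Spec.map R p₁ ≫ toD eps eps_sq) = τ
      rw [e₁, h3]
    · change χ.comp (Spec.map R p₂ ≫ toD eps eps_sq) = x₀
      rw [e₂, h4]

/-- The space `D × D`. -/
def DD (R : 𝒮 ⥤ CommAlgCat.{w} ℚ) : 𝒮 ⥤ Type w where
  obj A := (D R).obj A × (D R).obj A
  map f := ↾(fun d => ((D R).map f d.1, (D R).map f d.2))
  map_id A := by ext d <;> simp
  map_comp f g := by ext d <;> simp

/-- The comparison map `Spec_R (WDD) → D × D`. -/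
def toDD : Spec R WDD ⟶ DD R where
  app A := ↾(fun p => ((toD del₁ del₁_sq).app A p, (toD del₂ del₂_sq).app A p))
  naturality A B f := by ext p; rfl

theorem toDD_surjective (B : 𝒮) : Function.Surjective ((toDD (R := R)).app B) := by
  rintro ⟨⟨a, ha⟩, ⟨b, hb⟩⟩
  refine ⟨liftDD a b ha hb, Prod.ext (Subtype.ext ?_) (Subtype.ext ?_)⟩
  · change liftDD a b ha hb del₁ = a
    simp [liftDD_apply]
  · change liftDD a b ha hb del₂ = b
    simp [liftDD_apply]

/-- The multiplication `D × D → D`. -/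
def mulD (R : 𝒮 ⥤ CommAlgCat.{w} ℚ) : DD R ⟶ D R where
  app A := ↾(fun d => D.scale d.1.1 d.2)
  naturality A B f := by ext d; exact Subtype.ext (map_mul (R.map f).hom _ _).symm

theorem toDD_mulD : toDD (R := R) ≫ mulD R = toD (del₁ * del₂) del_sq := by
  ext A p
  exact Subtype.ext (map_mul (show WDD →ₐ[ℚ] R.obj A from p) del₁ del₂).symm

/-- The origin of `D × D`. -/
def DD.zero {R : 𝒮 ⥤ CommAlgCat.{w} ℚ} (A : 𝒮) : (DD R).obj A := (D.zero A, D.zero A)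

theorem D.map_zero {A B : 𝒮} (f : A ⟶ B) : (D R).map f (D.zero A) = D.zero B :=
  Subtype.ext (_root_.map_zero (R.map f).hom)

theorem DD.map_zero {A B : 𝒮} (f : A ⟶ B) : (DD R).map f (DD.zero A) = DD.zero B :=
  Prod.ext (D.map_zero f) (D.map_zero f)

theorem del_mul_zero {A : 𝒮} (p : WD2 →ₐ[ℚ] R.obj A) :
    p (liftDD eps₁ eps₂ eps₁_sq eps₂_sq del₁) * p (liftDD eps₁ eps₂ eps₁_sq eps₂_sq del₂) = 0 := by
  rw [← map_mul, ← map_mul]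
  have e : liftDD eps₁ eps₂ eps₁_sq eps₂_sq (del₁ * del₂) = 0 := by simp [liftDD_apply]
  rw [e, _root_.map_zero]

/-- A function on `D × D` with values in a microlinear space which is constant on `D(2)`
factors uniquely through the multiplication `D × D → D`. -/
theorem IsMicrolinear.factor {X : 𝒮 ⥤ Type w'} (hX : IsMicrolinear R X) {A : 𝒮}
    (τ : Fn (DD R) X A) (h : ∀ {B : 𝒮} (f : A ⟶ B) (d : (DD R).obj B), d.1.1 * d.2.1 = 0 →
      τ.toFun f d = τ.toFun f (DD.zero B)) :
    ∃! ψ : Fn (D R) X A, ψ.comp (mulD R) = τ := by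
  let x₀ : Fn (Spec R ℚ) X A :=
    { toFun := fun {B} f _ => τ.toFun f (DD.zero B)
      naturality := fun f g _ => by rw [τ.naturality, DD.map_zero] }
  obtain ⟨ψ, ⟨h1, h2⟩, hu⟩ := hX.factor_aux (τ.comp toDD) x₀ (by
    ext B f p
    exact h f _ (del_mul_zero (show WD2 →ₐ[ℚ] R.obj B from p)))
  refine ⟨ψ, ?_, ?_⟩
  · refine Fn.comp_injective toDD toDD_surjective ?_
    change ψ.comp (toDD ≫ mulD R) = _
    rw [toDD_mulD, h1]
  · intro χ hχ
    refine hu χ ⟨?_, ?_⟩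
    · rw [← toDD_mulD, ← hχ]
      rfl
    · ext B f p
      change _ = τ.toFun f (DD.zero B)
      rw [← hχ]
      change χ.toFun f _ = χ.toFun f _
      congr 1
      exact Subtype.ext ((_root_.map_zero (show ℚ →ₐ[ℚ] R.obj B from p)).trans (mul_zero _).symm)

end helpers

/-! ### Lie groups and their Lie algebras -/

/-- A Lie group: a group object which is microlinear as a space. -/
structure LieGroup (R : 𝒮 ⥤ CommAlgCat.{w} ℚ) where
  /-- The underlying group object. -/
  grp : 𝒮 ⥤ GrpCat.{w'}
  microlinear : IsMicrolinear R (grp ⋙ forget GrpCat.{w'})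

namespace LieGroup

variable {R : 𝒮 ⥤ CommAlgCat.{w} ℚ} (G : LieGroup.{u, v, w, w'} R)

/-- The underlying space of a Lie group. -/
abbrev space : 𝒮 ⥤ Type w' := G.grp ⋙ forget GrpCat.{w'}

/-- The elements at the stage `A` of the Lie algebra of `G`: the tangent vectors to `G` at `1`,
that is, the maps `X : D → G` with `X(0) = 1`. -/
@[ext]
structure Lie (A : 𝒮) extends Fn (D R) G.space A where
  map_zero : ∀ {B : 𝒮} (f : A ⟶ B), toFun f (D.zero B) = (1 : G.grp.obj B)

/-- The Lie algebra of `G` as a space. -/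
def lieSpace : 𝒮 ⥤ Type (max u v w w') where
  obj A := G.Lie A
  map f := ↾(fun X => ⟨X.toFn.restrict f, fun g => X.map_zero (f ≫ g)⟩)
  map_id A := by ext X; simp [Fn.restrict]
  map_comp f g := by ext X; simp [Fn.restrict]

/-- The product of two functions with values in `G`. -/
def mulFn {U : 𝒮 ⥤ Type w} {A : 𝒮} (φ ψ : Fn U G.space A) : Fn U G.space A where
  toFun {B} f x := ((φ.toFun f x : G.grp.obj B) * (ψ.toFun f x : G.grp.obj B) : G.grp.obj B)
  naturality {B C} f g x := by
    rw [← φ.naturality, ← ψ.naturality]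
    exact map_mul (G.grp.map g).hom _ _

/-- The inverse of a function with values in `G`. -/
def invFn {U : 𝒮 ⥤ Type w} {A : 𝒮} (φ : Fn U G.space A) : Fn U G.space A where
  toFun {B} f x := ((φ.toFun f x : G.grp.obj B)⁻¹ : G.grp.obj B)
  naturality {B C} f g x := by
    rw [← φ.naturality]
    exact map_inv (G.grp.map g).hom _

/-- The first projection `D(2) → D`. -/
def proj₁ (R : 𝒮 ⥤ CommAlgCat.{w} ℚ) : D2 R ⟶ D R where
  app A := ↾(fun d => ⟨d.1.1, d.2.1⟩)
  naturality A B f := by ext d; rfl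

/-- The second projection `D(2) → D`. -/
def proj₂ (R : 𝒮 ⥤ CommAlgCat.{w} ℚ) : D2 R ⟶ D R where
  app A := ↾(fun d => ⟨d.1.2, d.2.2.1⟩)
  naturality A B f := by ext d; rfl

/-- The first projection `D × D → D`. -/
def fstDD (R : 𝒮 ⥤ CommAlgCat.{w} ℚ) : DD R ⟶ D R where
  app A := ↾(fun d => d.1)
  naturality A B f := by ext d; rfl

/-- The second projection `D × D → D`. -/
def sndDD (R : 𝒮 ⥤ CommAlgCat.{w} ℚ) : DD R ⟶ D R where
  app A := ↾(fun d => d.2)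
  naturality A B f := by ext d; rfl

variable {G} {A : 𝒮}

/-- Two tangent vectors `X`, `Y` extend uniquely to a map `ℓ : D(2) → G` with `ℓ(d, 0) = X(d)` and
`ℓ(0, d) = Y(d)`. -/
theorem existsUnique_extend (X Y : G.Lie A) :
    ∃! ℓ : Fn (D2 R) G.space A, ℓ.comp (axis₁ R) = X.toFn ∧ ℓ.comp (axis₂ R) = Y.toFn := by
  refine ⟨G.mulFn (X.toFn.comp (proj₁ R)) (Y.toFn.comp (proj₂ R)), ⟨?_, ?_⟩, ?_⟩
  · ext B f d
    change (X.toFun f d : G.grp.obj B) * (Y.toFun f (D.zero B) : G.grp.obj B) = X.toFun f d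
    rw [Y.map_zero, mul_one]
  · ext B f d
    change (X.toFun f (D.zero B) : G.grp.obj B) * (Y.toFun f d : G.grp.obj B) = Y.toFun f d
    rw [X.map_zero, one_mul]
  · rintro ℓ ⟨h1, h2⟩
    refine G.microlinear.ext_D2 (h1.trans ?_) (h2.trans ?_)
    · ext B f d
      change _ = (X.toFun f d : G.grp.obj B) * (Y.toFun f (D.zero B) : G.grp.obj B)
      rw [Y.map_zero, mul_one]
    · ext B f d
      change _ = (X.toFun f (D.zero B) : G.grp.obj B) * (Y.toFun f d : G.grp.obj B)
      rw [X.map_zero, one_mul]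

/-- Addition of tangent vectors: `(X + Y)(d) = ℓ(d, d)`, where `ℓ : D(2) → G` is the unique map
with `ℓ(d, 0) = X(d)` and `ℓ(0, d) = Y(d)`. -/
noncomputable instance : Add (G.Lie A) where
  add X Y :=
    { toFn := (existsUnique_extend X Y).choose.comp (diag R)
      map_zero := fun {B} f => by
        have h := congrArg (fun χ => χ.toFun f (D.zero B)) (existsUnique_extend X Y).choose_spec.1.1
        exact h.trans (X.map_zero f) }

/-- Multiplication of a tangent vector by an element of the line: `(r X)(d) = X(r d)`. -/
instance : SMul (R.obj A) (G.Lie A) where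
  smul r X :=
    { toFun := fun {B} f d => X.toFun f (D.scale ((R.map f).hom r) d)
      naturality := fun {B C} f g d => by
        rw [X.naturality]
        congr 1
        refine Subtype.ext ?_
        change (R.map g).hom ((R.map f).hom r * d.1) = (R.map (f ≫ g)).hom r * (R.map g).hom d.1
        simp
      map_zero := fun {B} f => by
        have h : D.scale ((R.map f).hom r) (D.zero B) = D.zero B :=
          Subtype.ext (mul_zero ((R.map f).hom r))
        rw [h, X.map_zero] }

/-- Subtraction of tangent vectors: `X - Y = X + (-1) Y`. -/
noncomputable instance : Sub (G.Lie A) where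
  sub X Y := X + (-1 : R.obj A) • Y

theorem commute_of_mul_eq_zero (X Y : G.Lie A) {B : 𝒮} (f : A ⟶ B) (d e : (D R).obj B)
    (h : d.1 * e.1 = 0) :
    (X.toFun f d : G.grp.obj B) * (Y.toFun f e : G.grp.obj B) =
      (Y.toFun f e : G.grp.obj B) * (X.toFun f d : G.grp.obj B) := by
  have := G.microlinear.ext_D2 (A := A)
    (ℓ := G.mulFn (X.toFn.comp (proj₁ R)) (Y.toFn.comp (proj₂ R)))
    (ℓ' := G.mulFn (Y.toFn.comp (proj₂ R)) (X.toFn.comp (proj₁ R))) (by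
      ext B f d
      change (X.toFun f d : G.grp.obj B) * (Y.toFun f (D.zero B) : G.grp.obj B) =
        (Y.toFun f (D.zero B) : G.grp.obj B) * (X.toFun f d : G.grp.obj B)
      rw [Y.map_zero, mul_one, one_mul]) (by
      ext B f d
      change (X.toFun f (D.zero B) : G.grp.obj B) * (Y.toFun f d : G.grp.obj B) =
        (Y.toFun f d : G.grp.obj B) * (X.toFun f (D.zero B) : G.grp.obj B)
      rw [X.map_zero, mul_one, one_mul])
  exact congrArg (fun χ => χ.toFun f (⟨(d.1, e.1), d.2, e.2, h⟩ : (D2 R).obj B)) this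

/-- There is a unique tangent vector `Z` with
`Z(d₁ d₂) = X(d₁) Y(d₂) X(d₁)⁻¹ Y(d₂)⁻¹` for all `d₁, d₂` in `D`. -/
theorem existsUnique_bracket (X Y : G.Lie A) :
    ∃! Z : G.Lie A, ∀ {B : 𝒮} (f : A ⟶ B) (d₁ d₂ : (D R).obj B),
      (Z.toFun f (D.scale d₁.1 d₂) : G.grp.obj B) =
        (X.toFun f d₁ : G.grp.obj B) * (Y.toFun f d₂ : G.grp.obj B) *
          (X.toFun f d₁ : G.grp.obj B)⁻¹ * (Y.toFun f d₂ : G.grp.obj B)⁻¹ := by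
  let φ : Fn (DD R) G.space A := X.toFn.comp (fstDD R)
  let χ : Fn (DD R) G.space A := Y.toFn.comp (sndDD R)
  let τ : Fn (DD R) G.space A := G.mulFn (G.mulFn (G.mulFn φ χ) (G.invFn φ)) (G.invFn χ)
  have hτ : ∀ {B : 𝒮} (f : A ⟶ B) (d : (DD R).obj B), d.1.1 * d.2.1 = 0 →
      τ.toFun f d = (1 : G.grp.obj B) := by
    intro B f d hd
    change (X.toFun f d.1 : G.grp.obj B) * (Y.toFun f d.2 : G.grp.obj B) *
      (X.toFun f d.1 : G.grp.obj B)⁻¹ * (Y.toFun f d.2 : G.grp.obj B)⁻¹ = 1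
    rw [commute_of_mul_eq_zero X Y f d.1 d.2 hd, mul_inv_cancel_right, mul_inv_cancel]
  obtain ⟨ψ, h1, hu⟩ := G.microlinear.factor τ (by
    intro B f d hd
    rw [hτ f d hd, hτ f (DD.zero B) (mul_zero _)])
  refine ⟨⟨ψ, fun {B} f => ?_⟩, ?_, ?_⟩
  · rw [← hτ f (DD.zero B) (mul_zero _), ← h1]
    change ψ.toFun f _ = ψ.toFun f _
    congr 1
    exact Subtype.ext (mul_zero _).symm
  · intro B f d₁ d₂
    exact congrArg (fun χ => χ.toFun f ((d₁, d₂) : (DD R).obj B)) h1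
  · intro Z hZ
    refine Lie.ext (congrArg (fun χ : Fn (D R) G.space A => @χ.toFun) (hu Z.toFn ?_))
    ext B f d
    exact hZ f d.1 d.2

/-- The Lie bracket: `[X, Y]` is the unique tangent vector with
`[X, Y](d₁ d₂) = X(d₁) Y(d₂) X(d₁)⁻¹ Y(d₂)⁻¹` for all `d₁, d₂` in `D`. -/
noncomputable instance : Bracket (G.Lie A) (G.Lie A) where
  bracket X Y := (existsUnique_bracket X Y).choose

/-! ### Regular Lie groups and the exponential map -/

variable (R) in
/-- The sum `t + d` of an element `t` of the line and an element `d` of `D`. -/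
def shift {A : 𝒮} (t : (Line R).obj A) (d : (D R).obj A) : (Line R).obj A :=
  ((show R.obj A from t) + d.1 : R.obj A)

/-- The left logarithmic derivative of a curve `θ : R → G`: the curve in the Lie algebra whose value
at `t` is the tangent vector `d ↦ θ(t)⁻¹ θ(t + d)`. -/
def logDeriv (θ : Fn (Line R) G.space A) : Fn (Line R) G.lieSpace A where
  toFun {B} f t :=
    ({ toFun := fun {C} g d =>
        ((θ.toFun (f ≫ g) ((Line R).map g t) : G.grp.obj C)⁻¹ *
          (θ.toFun (f ≫ g) (shift R ((Line R).map g t) d) : G.grp.obj C) : G.grp.obj C)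
       naturality := fun {C C'} g h d => by
        have e₁ := θ.naturality (f ≫ g) h ((Line R).map g t)
        have e₂ := θ.naturality (f ≫ g) h (shift R ((Line R).map g t) d)
        have e₃ : (Line R).map h (shift R ((Line R).map g t) d) =
            shift R ((Line R).map (g ≫ h) t) ((D R).map h d) := by
          rw [Functor.map_comp]
          exact map_add (R.map h).hom _ _
        have e₄ : (Line R).map h ((Line R).map g t) = (Line R).map (g ≫ h) t := by simp
        rw [e₃] at e₂
        rw [e₄] at e₁
        rw [Category.assoc] at e₁ e₂
        rw [← e₁, ← e₂]
        exact (map_mul (G.grp.map h).hom _ _).trans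
          (congrArg (· * _) (map_inv (G.grp.map h).hom _))
       map_zero := fun {C} g => by
        have e : shift R ((Line R).map g t) (D.zero C) = (Line R).map g t := add_zero (R.map g t)
        rw [e]
        exact inv_mul_cancel _ } : G.Lie B)
  naturality {B C} f g t := by
    refine Lie.ext ?_
    funext E h d
    change (θ.toFun (f ≫ g ≫ h) ((Line R).map (g ≫ h) t) : G.grp.obj E)⁻¹ *
          (θ.toFun (f ≫ g ≫ h) (shift R ((Line R).map (g ≫ h) t) d) : G.grp.obj E) =
      (θ.toFun ((f ≫ g) ≫ h) ((Line R).map h ((Line R).map g t)) : G.grp.obj E)⁻¹ *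
          (θ.toFun ((f ≫ g) ≫ h) (shift R ((Line R).map h ((Line R).map g t)) d) : G.grp.obj E)
    rw [Category.assoc, Functor.map_comp]
    rfl

/-- `θ` is an integral curve of `ξ : R → 𝔤` starting at `1`: `θ(0) = 1` and the left logarithmic
derivative of `θ` is `ξ`. -/
def IsEvolution (ξ : Fn (Line R) G.lieSpace A) (θ : Fn (Line R) G.space A) : Prop :=
  (∀ {B : 𝒮} (f : A ⟶ B), θ.toFun f (0 : R.obj B) = (1 : G.grp.obj B)) ∧ logDeriv θ = ξ

variable (G) in
/-- A Lie group is regular if every curve `ξ : R → 𝔤` in its Lie algebra is the left logarithmic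
derivative of a unique curve `θ : R → G` with `θ(0) = 1`. -/
def IsRegular : Prop :=
  ∀ (A : 𝒮) (ξ : Fn (Line R) G.lieSpace A), ∃! θ : Fn (Line R) G.space A, IsEvolution ξ θ

/-- The constant curve with value `X`. -/
def constCurve (X : G.Lie A) : Fn (Line R) G.lieSpace A where
  toFun f _ := G.lieSpace.map f (show G.lieSpace.obj A from X)
  naturality f g _ := by simp

/-- The exponential map of a regular Lie group: `exp X = θ(1)`, where `θ : R → G` is the unique
curve with `θ(0) = 1` and constant left logarithmic derivative `X`. -/
noncomputable def exp (hG : G.IsRegular) (X : G.Lie A) : G.grp.obj A :=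
  (hG A (constCurve X)).choose.toFun (𝟙 A) (1 : R.obj A)

end LieGroup

end SDG

/-!
The parameter `δ = d₁ + d₂ + d₃` is reached from `0` by three increments of square zero, and the
formula is proved for `0`, `d₁`, `d₁ + d₂` and `δ` in turn.  An increment changes the argument of
each exponential by a multiple of some `d` with `d² = 0`, so what is needed is the differential of
the exponential map: if `ad_Z³ X = 0`, then

`exp (Z + d X) = exp Z · (X - ½ [Z, X] + ⅙ [Z, [Z, X]])(d)`    (`exp_add_smul`).

It holds because both sides extend to curves in `t` (replace `Z`, `X` by `t Z`, `t X`) which are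
integral curves of the constant curve `Z + d X`, and such curves are unique in a regular Lie group.
The verification moves one tangent vector past another by means of
`X(d) Y(e) = [X, Y](d e) Y(e) X(d)`, which is the definition of the bracket.

Inverting both sides for `-Z`, `-X` gives the mirror image `exp_add_smul'`; the two together give
the adjoint action `V(d) exp B = exp B · (V - [B, V] + ½ [B, [B, V]])(d)` (`flow_mul_exp`).  With
it, the induction step becomes an identity between tangent vectors (`exp_mul_exp_step`), where the
arguments are multiples `s P` with `s³ = 0`, so that all threefold brackets with them vanish.  This
identity is checked by comparing the coefficients of `1`, `s`, `s²` (`exp_cubic_mul_add`), using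
that the Lie algebra is a module with an alternating bilinear bracket; in this degree the Jacobi
identity does not enter.

Throughout, a tangent vector is evaluated through its one-parameter subgroup `flow`, which is
defined on the whole line and agrees with the tangent vector on `D` (`flow_of_sq`).
-/

namespace SDG.LieGroup

variable {𝒮 : Type u} [Category.{v} 𝒮] {R : 𝒮 ⥤ CommAlgCat.{w} ℚ} {G : LieGroup.{u, v, w, w'} R}
  {A : 𝒮}

/-! ### The Lie algebra as a module with a bilinear bracket -/

/-- The value of a tangent vector at an element `d` of the line with `d² = 0`, as an element of the
group at the given stage. -/
def Lie.val (X : G.Lie A) {B : 𝒮} (f : A ⟶ B) (d : R.obj B) (hd : d ^ 2 = 0) : G.grp.obj B :=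
  X.toFun f (⟨d, hd⟩ : {d : R.obj B // d ^ 2 = 0})

theorem Lie.ext_val {X Y : G.Lie A}
    (h : ∀ {B : 𝒮} (f : A ⟶ B) (d : R.obj B) (hd : d ^ 2 = 0), X.val f d hd = Y.val f d hd) :
    X = Y := by
  ext B f d
  exact h f d.1 d.2

theorem Lie.val_zero (X : G.Lie A) {B : 𝒮} (f : A ⟶ B) (h : (0 : R.obj B) ^ 2 = 0) :
    X.val f 0 h = 1 :=
  X.map_zero f

theorem Lie.val_add (X Y : G.Lie A) {B : 𝒮} (f : A ⟶ B) (d : R.obj B) (hd : d ^ 2 = 0) :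
    (X + Y).val f d hd = X.val f d hd * Y.val f d hd := by
  -- the product `X(d) Y(e)` is a map on `D(2)` with the right restrictions to the axes
  have h : (existsUnique_extend X Y).choose =
      G.mulFn (X.toFn.comp (proj₁ R)) (Y.toFn.comp (proj₂ R)) := by
    refine (existsUnique_extend X Y).unique (existsUnique_extend X Y).choose_spec.1 ⟨?_, ?_⟩
    · ext B f d
      change (X.toFun f d : G.grp.obj B) * (Y.toFun f (D.zero B) : G.grp.obj B) = X.toFun f d
      rw [Y.map_zero, mul_one]
    · ext B f d
      change (X.toFun f (D.zero B) : G.grp.obj B) * (Y.toFun f d : G.grp.obj B) = Y.toFun f d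
      rw [X.map_zero, one_mul]
  change ((existsUnique_extend X Y).choose.comp (diag R)).toFun f ⟨d, hd⟩ = _
  rw [h]
  rfl

theorem Lie.val_smul (r : R.obj A) (X : G.Lie A) {B : 𝒮} (f : A ⟶ B) (d : R.obj B)
    (hd : d ^ 2 = 0) :
    (r • X).val f d hd = X.val f ((R.map f).hom r * d) (by rw [mul_pow, hd, mul_zero]) :=
  rfl

/-- The addition `D(2) → D`. -/
def addD2 (R : 𝒮 ⥤ CommAlgCat.{w} ℚ) : D2 R ⟶ D R where
  app A := ↾(fun d => ⟨d.1.1 + d.1.2, by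
    linear_combination d.2.1 + d.2.2.1 + 2 * d.2.2.2⟩)
  naturality A B f := by ext d; exact Subtype.ext (map_add (R.map f).hom _ _).symm

/-- A tangent vector is additive on `D(2)`; this gives `(r + s) X = r X + s X`. -/
theorem Lie.val_add_arg (X : G.Lie A) {B : 𝒮} (f : A ⟶ B) (d e : R.obj B) (hd : d ^ 2 = 0)
    (he : e ^ 2 = 0) (h : d * e = 0) :
    X.val f (d + e) (by linear_combination hd + he + 2 * h) = X.val f d hd * X.val f e he := by
  have := G.microlinear.ext_D2 (A := A) (ℓ := X.toFn.comp (addD2 R))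
    (ℓ' := G.mulFn (X.toFn.comp (proj₁ R)) (X.toFn.comp (proj₂ R))) (by
      ext B f d
      change (X.val f (d.1 + 0) _ : G.grp.obj B) = X.val f d.1 d.2 * X.val f 0 _
      simp only [add_zero]
      exact ((congrArg (_ * ·) (X.val_zero f (by simp))).trans (mul_one _)).symm) (by
      ext B f d
      change (X.val f (0 + d.1) _ : G.grp.obj B) = X.val f 0 _ * X.val f d.1 d.2
      simp only [zero_add]
      exact ((congrArg (· * _) (X.val_zero f (by simp))).trans (one_mul _)).symm)
  exact congrArg (fun χ => χ.toFun f (⟨(d, e), hd, he, h⟩ : (D2 R).obj B)) this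

theorem Lie.val_commute (X Y : G.Lie A) {B : 𝒮} (f : A ⟶ B) (d e : R.obj B) (hd : d ^ 2 = 0)
    (he : e ^ 2 = 0) (h : d * e = 0) : Commute (X.val f d hd) (Y.val f e he) :=
  commute_of_mul_eq_zero X Y f ⟨d, hd⟩ ⟨e, he⟩ h

instance : Zero (G.Lie A) where
  zero :=
    { toFun := fun {B} _ _ => (1 : G.grp.obj B)
      naturality := fun _ g _ => map_one (G.grp.map g).hom
      map_zero := fun _ => rfl }

theorem Lie.zero_val {B : 𝒮} (f : A ⟶ B) (d : R.obj B) (hd : d ^ 2 = 0) :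
    (0 : G.Lie A).val f d hd = 1 :=
  rfl

instance : Neg (G.Lie A) where
  neg X := (-1 : R.obj A) • X

theorem Lie.neg_eq (X : G.Lie A) : -X = (-1 : R.obj A) • X := rfl

theorem Lie.val_neg_arg (X : G.Lie A) {B : 𝒮} (f : A ⟶ B) (d : R.obj B) (hd : d ^ 2 = 0) :
    X.val f (-d) (by rw [neg_sq, hd]) = (X.val f d hd)⁻¹ := by
  rw [eq_inv_iff_mul_eq_one, ← X.val_add_arg f (-d) d _ hd (by linear_combination -hd)]
  simp only [neg_add_cancel, X.val_zero]

theorem Lie.val_neg (X : G.Lie A) {B : 𝒮} (f : A ⟶ B) (d : R.obj B) (hd : d ^ 2 = 0) :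
    (-X).val f d hd = (X.val f d hd)⁻¹ := by
  rw [Lie.neg_eq, Lie.val_smul, ← Lie.val_neg_arg]
  simp only [map_neg, map_one, neg_one_mul]

noncomputable instance : AddCommGroup (G.Lie A) where
  add_assoc X Y Z := Lie.ext_val fun f d hd => by simp only [Lie.val_add, mul_assoc]
  zero_add X := Lie.ext_val fun f d hd => by rw [Lie.val_add, Lie.zero_val, one_mul]
  add_zero X := Lie.ext_val fun f d hd => by rw [Lie.val_add, Lie.zero_val, mul_one]
  add_comm X Y := Lie.ext_val fun f d hd => by
    rw [Lie.val_add, Lie.val_add, (X.val_commute Y f d d hd hd (by rw [← pow_two, hd])).eq]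
  neg_add_cancel X := Lie.ext_val fun f d hd => by
    rw [Lie.val_add, Lie.val_neg, inv_mul_cancel, Lie.zero_val]
  sub X Y := X - Y
  sub_eq_add_neg X Y := rfl
  nsmul := nsmulRec
  zsmul := zsmulRec

noncomputable instance : Module (R.obj A) (G.Lie A) where
  one_smul X := Lie.ext_val fun f d hd => by simp only [Lie.val_smul, map_one, one_mul]
  mul_smul r s X := Lie.ext_val fun f d hd => by
    simp only [Lie.val_smul, map_mul]
    congr 1
    ring
  smul_zero r := Lie.ext_val fun f d hd => by simp only [Lie.val_smul, Lie.zero_val]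
  zero_smul X := Lie.ext_val fun f d hd => by
    simp only [Lie.val_smul, Lie.zero_val, map_zero, zero_mul, Lie.val_zero]
  smul_add r X Y := Lie.ext_val fun f d hd => by simp only [Lie.val_smul, Lie.val_add]
  add_smul r s X := Lie.ext_val fun f d hd => by
    rw [Lie.val_add, Lie.val_smul, Lie.val_smul, Lie.val_smul,
      ← X.val_add_arg f _ _ _ _ (by
        linear_combination ((R.map f).hom r * (R.map f).hom s) * hd)]
    simp only [map_add, add_mul]

theorem Lie.bracket_val (X Y : G.Lie A) {B : 𝒮} (f : A ⟶ B) (d e : R.obj B) (hd : d ^ 2 = 0)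
    (he : e ^ 2 = 0) :
    ⁅X, Y⁆.val f (d * e) (by rw [mul_pow, hd, zero_mul]) =
      X.val f d hd * Y.val f e he * (X.val f d hd)⁻¹ * (Y.val f e he)⁻¹ :=
  (existsUnique_bracket X Y).choose_spec.1 f (⟨d, hd⟩ : {d : R.obj B // d ^ 2 = 0}) ⟨e, he⟩

theorem Lie.bracket_eq {X Y Z : G.Lie A}
    (h : ∀ {B : 𝒮} (f : A ⟶ B) (d e : R.obj B) (hd : d ^ 2 = 0) (he : e ^ 2 = 0),
      X.val f d hd * Y.val f e he * (X.val f d hd)⁻¹ * (Y.val f e he)⁻¹ =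
        Z.val f (d * e) (by rw [mul_pow, hd, zero_mul])) :
    ⁅X, Y⁆ = Z :=
  (existsUnique_bracket X Y).unique (existsUnique_bracket X Y).choose_spec.1
    fun f d e => (h f d.1 e.1 d.2 e.2).symm

theorem Lie.val_mul_val (X Y : G.Lie A) {B : 𝒮} (f : A ⟶ B) (d e : R.obj B) (hd : d ^ 2 = 0)
    (he : e ^ 2 = 0) :
    X.val f d hd * Y.val f e he =
      ⁅X, Y⁆.val f (d * e) (by rw [mul_pow, hd, zero_mul]) * Y.val f e he * X.val f d hd := by
  rw [Lie.bracket_val _ _ _ _ _ hd he]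
  group

theorem Lie.bracket_swap (X Y : G.Lie A) : ⁅X, Y⁆ = -⁅Y, X⁆ :=
  Lie.bracket_eq fun f d e hd he => by
    have := Lie.bracket_val Y X f e d he hd
    rw [Lie.val_neg]
    simp only [mul_comm d e, this]
    group

theorem Lie.smul_bracket (r : R.obj A) (X Y : G.Lie A) : ⁅r • X, Y⁆ = r • ⁅X, Y⁆ :=
  Lie.bracket_eq fun f d e hd he => by
    simp only [Lie.val_smul]
    rw [← Lie.bracket_val]
    congr 1
    ring

theorem Lie.add_bracket (X Y Z : G.Lie A) : ⁅X + Y, Z⁆ = ⁅X, Z⁆ + ⁅Y, Z⁆ :=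
  Lie.bracket_eq fun f d e hd he => by
    have h := (Lie.val_commute X ⁅Y, Z⁆ f d (d * e) hd (by rw [mul_pow, hd, zero_mul])
      (by linear_combination e * hd)).eq
    have h' := (Lie.val_commute ⁅X, Z⁆ ⁅Y, Z⁆ f (d * e) (d * e)
      (by rw [mul_pow, hd, zero_mul]) (by rw [mul_pow, hd, zero_mul])
      (by linear_combination e ^ 2 * hd)).eq
    have hX := Lie.bracket_val X Z f d e hd he
    have hY := Lie.val_mul_val Y Z f d e hd he
    rw [Lie.val_add, Lie.val_add, h', hX]
    calc _ = X.val f d hd * (Y.val f d hd * Z.val f e he) * (Y.val f d hd)⁻¹ *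
          (X.val f d hd)⁻¹ * (Z.val f e he)⁻¹ := by group
      _ = (X.val f d hd * ⁅Y, Z⁆.val f (d * e) _) * Z.val f e he * (X.val f d hd)⁻¹ *
          (Z.val f e he)⁻¹ := by rw [hY]; group
      _ = _ := by rw [h]; group

theorem Lie.bracket_add (X Y Z : G.Lie A) : ⁅X, Y + Z⁆ = ⁅X, Y⁆ + ⁅X, Z⁆ := by
  rw [Lie.bracket_swap, Lie.add_bracket, neg_add, ← Lie.bracket_swap,
    ← Lie.bracket_swap]

theorem Lie.bracket_smul (r : R.obj A) (X Y : G.Lie A) : ⁅X, r • Y⁆ = r • ⁅X, Y⁆ := by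
  rw [Lie.bracket_swap, Lie.smul_bracket, ← smul_neg, ← Lie.bracket_swap]

theorem Lie.neg_bracket (X Y : G.Lie A) : ⁅-X, Y⁆ = -⁅X, Y⁆ := by
  rw [Lie.neg_eq, Lie.smul_bracket, ← Lie.neg_eq]

theorem Lie.bracket_neg (X Y : G.Lie A) : ⁅X, -Y⁆ = -⁅X, Y⁆ := by
  rw [Lie.neg_eq, Lie.bracket_smul, ← Lie.neg_eq]

/-! ### One-parameter subgroups -/

/-- The value at `t` of a curve in `G`, as an element of the group at the given stage. -/
def curveVal (θ : Fn (Line R) G.space A) {B : 𝒮} (f : A ⟶ B) (t : R.obj B) : G.grp.obj B :=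
  θ.toFun f t

/-- A family of elements of `G`, indexed by the elements of the line at the stages after `A` and
compatible with restriction, as a curve. -/
def mkCurve (c : ∀ {B : 𝒮}, (A ⟶ B) → R.obj B → G.grp.obj B)
    (hc : ∀ {B C : 𝒮} (f : A ⟶ B) (g : B ⟶ C) (t : R.obj B),
      (G.grp.map g).hom (c f t) = c (f ≫ g) ((R.map g).hom t)) : Fn (Line R) G.space A where
  toFun f t := c f t
  naturality f g t := hc f g t

theorem isEvolution_constCurve_iff (X : G.Lie A) (θ : Fn (Line R) G.space A) :
    IsEvolution (constCurve X) θ ↔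
      (∀ {B : 𝒮} (f : A ⟶ B), curveVal θ f 0 = 1) ∧
        ∀ {B : 𝒮} (f : A ⟶ B) (t d : R.obj B) (hd : d ^ 2 = 0),
          curveVal θ f (t + d) = curveVal θ f t * X.val f d hd := by
  refine and_congr Iff.rfl ⟨fun h B f t d hd => ?_, fun h => ?_⟩
  · have h1 : (curveVal θ (f ≫ 𝟙 B) ((R.map (𝟙 B)).hom t))⁻¹ *
        curveVal θ (f ≫ 𝟙 B) ((R.map (𝟙 B)).hom t + d) = X.val (f ≫ 𝟙 B) d hd :=
      congrArg (fun χ : Fn (Line R) G.lieSpace A =>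
        (show G.Lie B from χ.toFun f t).val (𝟙 B) d hd) h
    have e : (R.map (𝟙 B)).hom t = t := by simp
    rw [e, Category.comp_id, inv_mul_eq_iff_eq_mul] at h1
    exact h1
  · ext B f t
    refine Lie.ext_val (A := B) fun {C} g d hd => ?_
    exact inv_mul_eq_iff_eq_mul.2 (h (f ≫ g) ((R.map g).hom t) d hd)

/-- The one-parameter subgroup `t ↦ exp (t X)`: the value at `t` of the integral curve of the
constant curve `X`. -/
noncomputable def flow (hG : G.IsRegular) (X : G.Lie A) {B : 𝒮} (f : A ⟶ B) (t : R.obj B) :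
    G.grp.obj B :=
  curveVal (hG A (constCurve X)).choose f t

variable (hG : G.IsRegular)

theorem exp_eq_flow (X : G.Lie A) : exp hG X = flow hG X (𝟙 A) 1 := rfl

theorem map_flow (X : G.Lie A) {B C : 𝒮} (f : A ⟶ B) (g : B ⟶ C) (t : R.obj B) :
    (G.grp.map g).hom (flow hG X f t) = flow hG X (f ≫ g) ((R.map g).hom t) :=
  (hG A (constCurve X)).choose.naturality f g t

theorem flow_zero (X : G.Lie A) {B : 𝒮} (f : A ⟶ B) : flow hG X f 0 = 1 :=
  ((isEvolution_constCurve_iff X _).1 (hG A (constCurve X)).choose_spec.1).1 f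

theorem flow_add_of_sq (X : G.Lie A) {B : 𝒮} (f : A ⟶ B) (t d : R.obj B) (hd : d ^ 2 = 0) :
    flow hG X f (t + d) = flow hG X f t * X.val f d hd :=
  ((isEvolution_constCurve_iff X _).1 (hG A (constCurve X)).choose_spec.1).2 f t d hd

theorem flow_of_sq (X : G.Lie A) {B : 𝒮} (f : A ⟶ B) (d : R.obj B) (hd : d ^ 2 = 0) :
    flow hG X f d = X.val f d hd := by
  have h := flow_add_of_sq hG X f 0 d hd
  rwa [zero_add, flow_zero, one_mul] at h

/-- Uniqueness of integral curves, for constant curves in the Lie algebra. -/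
theorem eq_flow (X : G.Lie A) (c : ∀ {B : 𝒮}, (A ⟶ B) → R.obj B → G.grp.obj B)
    (hc : ∀ {B C : 𝒮} (f : A ⟶ B) (g : B ⟶ C) (t : R.obj B),
      (G.grp.map g).hom (c f t) = c (f ≫ g) ((R.map g).hom t))
    (h0 : ∀ {B : 𝒮} (f : A ⟶ B), c f 0 = 1)
    (h : ∀ {B : 𝒮} (f : A ⟶ B) (t d : R.obj B), d ^ 2 = 0 →
      c f (t + d) = c f t * flow hG X f d)
    {B : 𝒮} (f : A ⟶ B) (t : R.obj B) : c f t = flow hG X f t := by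
  have := (hG A (constCurve X)).unique (y₁ := mkCurve c hc)
    ((isEvolution_constCurve_iff X _).2 ⟨h0, fun f t d hd => by
      rw [← flow_of_sq hG]; exact h f t d hd⟩) (hG A (constCurve X)).choose_spec.1
  exact congrArg (fun θ => curveVal θ f t) this

/-- Restriction of a tangent vector to a later stage. -/
def Lie.restrict (X : G.Lie A) {B : 𝒮} (f : A ⟶ B) : G.Lie B :=
  ⟨X.toFn.restrict f, fun g => X.map_zero (f ≫ g)⟩

theorem flow_restrict (X : G.Lie A) {B C : 𝒮} (f : A ⟶ B) (g : B ⟶ C) (t : R.obj C) :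
    flow hG (X.restrict f) g t = flow hG X (f ≫ g) t := by
  refine (eq_flow hG (X.restrict f) (fun g t => flow hG X (f ≫ g) t) ?_ ?_ ?_ g t).symm
  · intro B C g h t
    rw [map_flow, Category.assoc]
  · intro B g
    exact flow_zero hG X _
  · intro B g t d hd
    rw [flow_add_of_sq hG X _ t d hd, flow_of_sq hG _ _ d hd]
    rfl

theorem flow_add (X : G.Lie A) {B : 𝒮} (f : A ⟶ B) (s t : R.obj B) :
    flow hG X f (s + t) = flow hG X f s * flow hG X f t := by
  -- `t ↦ θ(s)⁻¹ θ(s + t)` is again an integral curve of `X`, starting at the stage of `s`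
  have h := eq_flow hG (X.restrict f)
    (fun {C} g t => (flow hG X (f ≫ g) ((R.map g).hom s))⁻¹ *
      flow hG X (f ≫ g) ((R.map g).hom s + t)) ?_ ?_ ?_ (𝟙 B) t
  · rw [flow_restrict] at h
    rw [inv_mul_eq_iff_eq_mul] at h
    simpa using h
  · intro B C g h t
    rw [map_mul, map_inv, map_flow, map_flow, map_add, Category.assoc, Functor.map_comp]
    rfl
  · intro B g
    rw [add_zero, inv_mul_cancel]
  · intro B g t d hd
    rw [← add_assoc, flow_add_of_sq hG X _ _ d hd, flow_restrict, flow_of_sq hG _ _ d hd, mul_assoc]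

theorem flow_neg (X : G.Lie A) {B : 𝒮} (f : A ⟶ B) (t : R.obj B) :
    flow hG X f (-t) = (flow hG X f t)⁻¹ := by
  rw [eq_inv_iff_mul_eq_one, ← flow_add, neg_add_cancel, flow_zero]

theorem flow_smul (r : R.obj A) (X : G.Lie A) {B : 𝒮} (f : A ⟶ B) (t : R.obj B) :
    flow hG (r • X) f t = flow hG X f ((R.map f).hom r * t) := by
  refine (eq_flow hG (r • X) (fun f t => flow hG X f ((R.map f).hom r * t)) ?_ ?_ ?_ f t).symm
  · intro B C f g t
    rw [map_flow, map_mul, Functor.map_comp]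
    rfl
  · intro B f
    rw [mul_zero, flow_zero]
  · intro B f t d hd
    rw [mul_add, flow_add, flow_of_sq hG (r • X) f d hd, Lie.val_smul, ← flow_of_sq hG]

theorem exp_neg (X : G.Lie A) : exp hG (-X) = (exp hG X)⁻¹ := by
  rw [exp_eq_flow, exp_eq_flow, Lie.neg_eq, flow_smul, ← flow_neg]
  simp

theorem exp_smul (r : R.obj A) (X : G.Lie A) : exp hG (r • X) = flow hG X (𝟙 A) r := by
  rw [exp_eq_flow, flow_smul]
  simp

theorem flow_lie_add (X Y : G.Lie A) {B : 𝒮} (f : A ⟶ B) (d : R.obj B) (hd : d ^ 2 = 0) :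
    flow hG (X + Y) f d = flow hG X f d * flow hG Y f d := by
  simp only [flow_of_sq hG _ f d hd, Lie.val_add]

theorem flow_mul_flow (X Y : G.Lie A) {B : 𝒮} (f : A ⟶ B) (d e : R.obj B) (hd : d ^ 2 = 0)
    (he : e ^ 2 = 0) :
    flow hG X f d * flow hG Y f e = flow hG ⁅X, Y⁆ f (d * e) * flow hG Y f e * flow hG X f d := by
  rw [flow_of_sq hG X f d hd, flow_of_sq hG Y f e he,
    flow_of_sq hG _ f (d * e) (by rw [mul_pow, hd, zero_mul]), ← Lie.val_mul_val]

theorem flow_commute (X Y : G.Lie A) {B : 𝒮} (f : A ⟶ B) (d e : R.obj B) (hd : d ^ 2 = 0)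
    (he : e ^ 2 = 0) (h : d * e = 0) : Commute (flow hG X f d) (flow hG Y f e) := by
  rw [flow_of_sq hG X f d hd, flow_of_sq hG Y f e he]
  exact Lie.val_commute X Y f d e hd he h

/-- The bracket is alternating because a one-parameter subgroup is commutative. -/
theorem Lie.bracket_self (hG : G.IsRegular) (X : G.Lie A) : ⁅X, X⁆ = 0 :=
  Lie.bracket_eq fun f d e hd he => by
    simp only [← flow_of_sq hG]
    rw [← flow_add, add_comm, flow_add, flow_of_sq hG (0 : G.Lie A) f (d * e)
      (by rw [mul_pow, hd, zero_mul]), Lie.zero_val]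
    group

/-! ### The differential of the exponential map -/

/-- The rearrangement behind the differential equation for `exp (Z + d X)`: `z` moves to the right
past `a` and `b` at the cost of `q` and `r⁻¹`, which cancel the increments of `b` and `c`. -/
theorem mul_rearrange {H : Type*} [Group H] {z a b c p q r : H}
    (hza : z * a = q * a * z) (hzb : z * b = r⁻¹ * b * z) (hzc : Commute z c)
    (har : Commute a r) (hpb : Commute p b) (hpc : Commute p c) (hqa : Commute q a)
    (hqb : Commute q b) (hqc : Commute q c) (hqz : Commute q z) (hqp : Commute q p)
    (hrb : Commute r b) (hrc : Commute r c) (hrz : Commute r z) (hrp : Commute r p) :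
    z * ((a * p) * (b * q⁻¹) * (c * r)) = a * b * c * (z * p) := by
  have hza' : z * a = a * z * q := by rw [hza, mul_assoc, (hqa.mul_right hqz).eq]
  have hzb' : z * b = b * z * r⁻¹ := by rw [hzb, mul_assoc, (hrb.mul_right hrz).inv_left.eq]
  have hrq : Commute r q := by
    have : q = z * a * z⁻¹ * a⁻¹ := by rw [hza]; group
    rw [this]
    exact ((hrz.mul_right har.symm).mul_right hrz.inv_right).mul_right har.symm.inv_right
  calc z * ((a * p) * (b * q⁻¹) * (c * r))
      = z * a * (p * b) * (q⁻¹ * c) * r := by group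
    _ = a * z * q * (b * p) * (c * q⁻¹) * r := by rw [hza', hpb.eq, hqc.inv_left.eq]
    _ = a * z * (q * b) * (p * c) * (q⁻¹ * r) := by group
    _ = a * (z * b) * (q * c) * p * (r * q⁻¹) := by
      rw [hqb.eq, hpc.eq, hrq.inv_right.eq]; group
    _ = a * b * z * r⁻¹ * (c * q) * p * (r * q⁻¹) := by rw [hzb', hqc.eq]; group
    _ = a * b * z * (r⁻¹ * c) * (q * (p * r)) * q⁻¹ := by group
    _ = a * b * (z * c) * (r⁻¹ * (q * (r * p))) * q⁻¹ := by
      rw [hrc.inv_left.eq, hrp.eq]; group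
    _ = a * b * c * z * (r⁻¹ * (q * r) * p) * q⁻¹ := by rw [hzc.eq]; group
    _ = a * b * c * z * (q * p) * q⁻¹ := by rw [← hrq.eq]; group
    _ = a * b * c * (z * p) := by rw [hqp.eq]; group

/-- The differential of the exponential map at `Z`, in the direction `X` killed by `ad_Z³`:
`exp (Z + d X) = exp Z · (X - ½ [Z, X] + ⅙ [Z, [Z, X]])(d)`.  Both sides are values at `1` of
integral curves of `Z + d X`, the right-hand curve being
`t ↦ exp (t Z) · (t X - ½ t² [Z, X] + ⅙ t³ [Z, [Z, X]])(d)`. -/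
theorem exp_add_smul (Z X : G.Lie A) (h3 : ⁅Z, ⁅Z, ⁅Z, X⁆⁆⁆ = 0) (d : R.obj A) (hd : d ^ 2 = 0) :
    exp hG (Z + d • X) = exp hG Z *
      flow hG (X - algebraMap ℚ (R.obj A) (1 / 2) • ⁅Z, X⁆ +
        algebraMap ℚ (R.obj A) (1 / 6) • ⁅Z, ⁅Z, X⁆⁆) (𝟙 A) d := by
  have hdf : ∀ {B : 𝒮} (f : A ⟶ B), (R.map f).hom d ^ 2 = 0 := fun f => by
    rw [← map_pow, hd, map_zero]
  have key := eq_flow hG (Z + d • X) (fun {B} f t => flow hG Z f t *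
    (flow hG X f (t * (R.map f).hom d) *
      flow hG ⁅Z, X⁆ f (-(algebraMap ℚ (R.obj B) (1 / 2) * t ^ 2 * (R.map f).hom d)) *
      flow hG ⁅Z, ⁅Z, X⁆⁆ f (algebraMap ℚ (R.obj B) (1 / 6) * t ^ 3 * (R.map f).hom d)))
    ?_ ?_ ?_ (𝟙 A) 1
  · rw [exp_eq_flow, ← key, exp_eq_flow, sub_eq_add_neg, Lie.neg_eq, flow_lie_add _ _ _ _ _ hd,
      flow_lie_add _ _ _ _ _ hd]
    have n : ∀ x : R.obj A, flow hG ⁅Z, X⁆ (𝟙 A) (-(x * d)) = flow hG (-x • ⁅Z, X⁆) (𝟙 A) d :=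
      fun x => by rw [flow_smul]; simp
    simp [flow_smul, n]
  · intro B C f g t
    simp only [map_mul, map_neg, map_pow, map_flow, AlgHom.commutes, Functor.map_comp]
    rfl
  · intro B f
    simp [flow_zero]
  · intro B f t e he
    have hdB := hdf f
    set δ := (R.map f).hom d with hδ
    set h := algebraMap ℚ (R.obj B) (1 / 2) with hh
    set k := algebraMap ℚ (R.obj B) (1 / 6) with hk
    have hh2 : 2 * h = 1 := by
      rw [hh, ← map_ofNat (algebraMap ℚ (R.obj B)) 2, ← map_mul]; norm_num
    have hk3 : 3 * k = h := by
      rw [hh, hk, ← map_ofNat (algebraMap ℚ (R.obj B)) 3, ← map_mul]; norm_num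
    -- the increments of the three coefficients when `t` becomes `t + e` with `e² = 0`
    have e1 : (t + e) * δ = t * δ + e * δ := by ring
    have e2 : -(h * (t + e) ^ 2 * δ) = -(h * t ^ 2 * δ) + -(e * (t * δ)) := by
      linear_combination -h * δ * he - e * t * δ * hh2
    have e3 : k * (t + e) ^ 3 * δ = k * t ^ 3 * δ + e * (h * t ^ 2 * δ) := by
      linear_combination k * δ * (3 * t + e) * he + e * t ^ 2 * δ * hk3
    have sq : ∀ x : R.obj B, (x * δ) ^ 2 = 0 := fun x => by rw [mul_pow, hdB, mul_zero]
    have sq' : ∀ x : R.obj B, (-(x * δ)) ^ 2 = 0 := fun x => by rw [neg_sq, sq]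
    -- factors whose arguments have vanishing product commute, here by `δ² = 0` and by `e² = 0`
    have comm : ∀ (U V : G.Lie A) (x y : R.obj B),
        Commute (flow hG U f (x * δ)) (flow hG V f (y * δ)) := fun U V x y =>
      flow_commute hG U V f _ _ (sq x) (sq y) (by linear_combination x * y * hdB)
    have comm' : ∀ (U V : G.Lie A) (x : R.obj B),
        Commute (flow hG U f (e * x * δ)) (flow hG V f e) := fun U V x =>
      flow_commute hG U V f _ _ (sq _) he (by linear_combination x * δ * he)
    rw [e1, e2, e3, flow_add, flow_add, flow_add, flow_add, flow_neg _ _ _ (e * (t * δ)),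
      mul_assoc (flow hG Z f t), mul_assoc (flow hG Z f t), flow_lie_add _ _ _ _ _ he,
      flow_smul, ← hδ]
    congr 1
    have n : -(h * t ^ 2 * δ) = (-(h * t ^ 2)) * δ := by ring
    have n1 : e * (t * δ) = e * t * δ := by ring
    have n2 : e * (h * t ^ 2 * δ) = e * (h * t ^ 2) * δ := by ring
    have n3 : δ * e = e * 1 * δ := by ring
    have n4 : e * δ = e * 1 * δ := by ring
    rw [n3, n4]
    apply mul_rearrange
    · rw [flow_mul_flow _ _ _ _ _ _ he (sq _)]
    · rw [flow_mul_flow _ _ _ _ _ _ he (sq' _), ← flow_neg]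
      congr 3
      ring
    · have := flow_mul_flow hG Z ⁅Z, ⁅Z, X⁆⁆ f e (k * t ^ 3 * δ) he (sq _)
      rw [h3, flow_of_sq hG (0 : G.Lie A) _ _ (by rw [mul_pow, he, zero_mul]), Lie.zero_val,
        one_mul] at this
      exact this
    all_goals try simp only [n, n1, n2]
    all_goals first | exact comm _ _ _ _ | exact comm' _ _ _

/-- The formula of `exp_add_smul` with the second factor on the left. -/
theorem exp_add_smul' (Z X : G.Lie A) (h3 : ⁅Z, ⁅Z, ⁅Z, X⁆⁆⁆ = 0) (d : R.obj A) (hd : d ^ 2 = 0) :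
    exp hG (Z + d • X) =
      flow hG (X + algebraMap ℚ (R.obj A) (1 / 2) • ⁅Z, X⁆ +
        algebraMap ℚ (R.obj A) (1 / 6) • ⁅Z, ⁅Z, X⁆⁆) (𝟙 A) d * exp hG Z := by
  have h := exp_add_smul hG (-Z) (-X)
    (by simp only [Lie.neg_bracket, Lie.bracket_neg, h3, neg_zero, neg_neg]) d hd
  rw [smul_neg, ← neg_add, exp_neg, exp_neg, ← inv_inj, inv_inv, mul_inv_rev, inv_inv,
    ← flow_neg] at h
  rw [h]
  have e : -d = (R.map (𝟙 A)).hom (-1) * d := by simp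
  rw [e, ← flow_smul]
  congr 2
  simp only [Lie.neg_bracket, Lie.bracket_neg, neg_neg]
  module

/-- The adjoint action of `exp B` when `ad_B³ = 0`:
`V(d) · exp B = exp B · (V - [B, V] + ½ [B, [B, V]])(d)`. -/
theorem flow_mul_exp (B V : G.Lie A) (h3 : ∀ X : G.Lie A, ⁅B, ⁅B, ⁅B, X⁆⁆⁆ = 0) (d : R.obj A)
    (hd : d ^ 2 = 0) :
    flow hG V (𝟙 A) d * exp hG B =
      exp hG B * flow hG (V - ⁅B, V⁆ + algebraMap ℚ (R.obj A) (1 / 2) • ⁅B, ⁅B, V⁆⁆) (𝟙 A) d := by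
  -- the direction `X` for which `exp_add_smul'` has the left factor `V(d)`
  set X := V - algebraMap ℚ (R.obj A) (1 / 2) • ⁅B, V⁆ +
    algebraMap ℚ (R.obj A) (1 / 12) • ⁅B, ⁅B, V⁆⁆ with hX
  have e1 : ⁅B, X⁆ = ⁅B, V⁆ - algebraMap ℚ (R.obj A) (1 / 2) • ⁅B, ⁅B, V⁆⁆ := by
    simp only [hX, sub_eq_add_neg, Lie.bracket_add, Lie.bracket_smul, Lie.bracket_neg, h3,
      smul_zero, add_zero]
  have e2 : ⁅B, ⁅B, X⁆⁆ = ⁅B, ⁅B, V⁆⁆ := by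
    simp only [e1, sub_eq_add_neg, Lie.bracket_add, Lie.bracket_smul, Lie.bracket_neg, h3,
      smul_zero, add_zero, neg_zero]
  have h := (exp_add_smul' hG B X (h3 X) d hd).symm.trans (exp_add_smul hG B X (h3 X) d hd)
  rw [e2, e1] at h
  set k := algebraMap ℚ (R.obj A) (1 / 6) with hk6
  have hk : 6 * k = 1 := by
    rw [hk6, ← map_ofNat (algebraMap ℚ (R.obj A)) 6, ← map_mul]; norm_num
  have ek : algebraMap ℚ (R.obj A) (1 / 2) = 3 * k := by
    rw [hk6, ← map_ofNat (algebraMap ℚ (R.obj A)) 3, ← map_mul]; norm_num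
  have e12 : algebraMap ℚ (R.obj A) (1 / 12) = 3 * k ^ 2 := by
    rw [hk6, ← map_pow, ← map_ofNat (algebraMap ℚ (R.obj A)) 3, ← map_mul]; norm_num
  convert h using 3
  · rw [hX, ek, e12]
    match_scalars
    · ring
    · ring
    · linear_combination k * hk
  · rw [hX, ek, e12]
    match_scalars
    · ring
    · linear_combination hk
    · linear_combination -2 * k * hk

/-- The induction step for products of exponentials: adding an increment `d` with `d² = 0` to the
parameter reduces an identity in the group to an identity between tangent vectors. -/
theorem exp_mul_exp_step {a b c u v w : G.Lie A}
    (ha : ∀ X : G.Lie A, ⁅a, ⁅a, ⁅a, X⁆⁆⁆ = 0) (hb : ∀ X : G.Lie A, ⁅b, ⁅b, ⁅b, X⁆⁆⁆ = 0)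
    (hc : ∀ X : G.Lie A, ⁅c, ⁅c, ⁅c, X⁆⁆⁆ = 0) (habc : exp hG a * exp hG b = exp hG c)
    {u' v' w' : G.Lie A}
    (hu : u' = u - algebraMap ℚ (R.obj A) (1 / 2) • ⁅a, u⁆ +
      algebraMap ℚ (R.obj A) (1 / 6) • ⁅a, ⁅a, u⁆⁆)
    (hv : v' = v - algebraMap ℚ (R.obj A) (1 / 2) • ⁅b, v⁆ +
      algebraMap ℚ (R.obj A) (1 / 6) • ⁅b, ⁅b, v⁆⁆)
    (hw : w' = w - algebraMap ℚ (R.obj A) (1 / 2) • ⁅c, w⁆ +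
      algebraMap ℚ (R.obj A) (1 / 6) • ⁅c, ⁅c, w⁆⁆)
    (h : u' - ⁅b, u'⁆ + algebraMap ℚ (R.obj A) (1 / 2) • ⁅b, ⁅b, u'⁆⁆ + v' = w')
    (d : R.obj A) (hd : d ^ 2 = 0) :
    exp hG (a + d • u) * exp hG (b + d • v) = exp hG (c + d • w) := by
  rw [exp_add_smul hG a u (ha u) d hd, exp_add_smul hG b v (hb v) d hd,
    exp_add_smul hG c w (hc w) d hd, ← hu, ← hv, ← hw, ← h, flow_lie_add _ _ _ _ _ hd, ← habc,
    mul_assoc, ← mul_assoc (flow hG u' (𝟙 A) d), flow_mul_exp hG b u' hb d hd]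
  simp only [mul_assoc]

/-! ### Expansion in powers of the parameter -/

theorem ad_smul_pow_three {s : R.obj A} (hs : s ^ 3 = 0) (P X : G.Lie A) :
    ⁅s • P, ⁅s • P, ⁅s • P, X⁆⁆⁆ = 0 := by
  simp only [Lie.smul_bracket, Lie.bracket_smul, smul_smul]
  rw [show s * s * s = 0 by linear_combination hs, zero_smul]

theorem two_mul_algebraMap_half (K : Type*) [CommRing K] [Algebra ℚ K] :
    2 * algebraMap ℚ K (1 / 2) = 1 := by
  rw [← map_ofNat (algebraMap ℚ K) 2, ← map_mul]
  norm_num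

/-- The expression of `exp_add_smul` for `Z = s • P` and `X = v`, where `s • P` is the curve
`s a + ½ s² b` and `v` is the derivative of `s a + ½ s² b + ⅙ s³ c`. -/
theorem dexp_curve (hG : G.IsRegular) {s : R.obj A} (hs : s ^ 3 = 0)
    (a b c : G.Lie A) {P v : G.Lie A} (hP : P = a + (algebraMap ℚ (R.obj A) (1 / 2) * s) • b)
    (hv : v = a + s • b + (algebraMap ℚ (R.obj A) (1 / 2) * s ^ 2) • c) :
    v - algebraMap ℚ (R.obj A) (1 / 2) • ⁅s • P, v⁆ +
      algebraMap ℚ (R.obj A) (1 / 6) • ⁅s • P, ⁅s • P, v⁆⁆ =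
    a + s • b + s ^ 2 • (algebraMap ℚ (R.obj A) (1 / 2) • c -
      algebraMap ℚ (R.obj A) (1 / 2) ^ 2 • ⁅a, b⁆) := by
  have h2 := two_mul_algebraMap_half (R.obj A)
  set h := algebraMap ℚ (R.obj A) (1 / 2)
  have h1 : ⁅s • P, v⁆ = (h * s ^ 2) • ⁅a, b⁆ := by
    simp only [hP, hv, Lie.add_bracket, Lie.bracket_add, Lie.smul_bracket, Lie.bracket_smul,
      Lie.bracket_self hG, Lie.bracket_swap b a]
    match_scalars
    · linear_combination -s ^ 2 * h2
    · linear_combination h * hs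
    · linear_combination h ^ 2 * s * hs
  have h0 : ⁅s • P, ⁅s • P, v⁆⁆ = 0 := by
    rw [h1, Lie.smul_bracket, Lie.bracket_smul, smul_smul,
      show s * (h * s ^ 2) = 0 by linear_combination h * hs, zero_smul]
  rw [h0, h1, hv]
  module

/-- The curve `s a + ½ s² b + ⅙ s³ c` in the Lie algebra. -/
noncomputable def cubic (a b c : G.Lie A) (s : R.obj A) : G.Lie A :=
  s • a + ((1 / 2 : ℚ) • s ^ 2) • b + ((1 / 6 : ℚ) • s ^ 3) • c

theorem cubic_add {s d : R.obj A} (hs : s ^ 3 = 0) (hd : d ^ 2 = 0) (a b c : G.Lie A) :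
    cubic a b c (s + d) = s • (a + (algebraMap ℚ (R.obj A) (1 / 2) * s) • b) +
      d • (a + s • b + (algebraMap ℚ (R.obj A) (1 / 2) * s ^ 2) • c) := by
  have h2 := two_mul_algebraMap_half (R.obj A)
  have h6 : algebraMap ℚ (R.obj A) (1 / 2) = 3 * algebraMap ℚ (R.obj A) (1 / 6) := by
    rw [← map_ofNat (algebraMap ℚ (R.obj A)) 3, ← map_mul]
    norm_num
  simp only [cubic, Algebra.smul_def]
  match_scalars
  · ring
  · linear_combination algebraMap ℚ (R.obj A) (1 / 2) * hd + s * d * h2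
  · linear_combination algebraMap ℚ (R.obj A) (1 / 6) * (hs + (3 * s + d) * hd) - d * s ^ 2 * h6

/-- Adding an increment `d` with `d² = 0` to a parameter `s` with `s³ = 0` preserves the
Baker-Campbell-Hausdorff identity. -/
theorem exp_cubic_mul_add (hG : G.IsRegular) (X₁ X₂ X₃ Y₁ Y₂ Y₃ : G.Lie A) {s d : R.obj A}
    (hs : s ^ 3 = 0) (hd : d ^ 2 = 0) {Z₁ Z₂ Z₃ : G.Lie A} (h₁ : Z₁ = X₁ + Y₁)
    (h₂ : Z₂ = X₂ + Y₂ + ⁅X₁, Y₁⁆)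
    (h₃ : Z₃ = (X₃ + Y₃) + (algebraMap ℚ (R.obj A) (3 / 2)) • (⁅X₁, Y₂⁆ + ⁅X₂, Y₁⁆) +
      (algebraMap ℚ (R.obj A) (1 / 2)) • ⁅X₁ - Y₁, ⁅X₁, Y₁⁆⁆)
    (ih : exp hG (cubic X₁ X₂ X₃ s) * exp hG (cubic Y₁ Y₂ Y₃ s) = exp hG (cubic Z₁ Z₂ Z₃ s)) :
    exp hG (cubic X₁ X₂ X₃ (s + d)) * exp hG (cubic Y₁ Y₂ Y₃ (s + d)) =
      exp hG (cubic Z₁ Z₂ Z₃ (s + d)) := by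
  have e : ∀ a b c : G.Lie A,
      cubic a b c s = s • (a + (algebraMap ℚ (R.obj A) (1 / 2) * s) • b) := fun a b c => by
    have := cubic_add hs (zero_pow two_ne_zero) a b c
    rwa [add_zero, zero_smul, add_zero] at this
  rw [e, e, e] at ih
  rw [cubic_add hs hd, cubic_add hs hd, cubic_add hs hd]
  refine exp_mul_exp_step hG (ad_smul_pow_three hs _) (ad_smul_pow_three hs _)
    (ad_smul_pow_three hs _) ih (dexp_curve hG hs _ _ _ rfl rfl).symm
    (dexp_curve hG hs _ _ _ rfl rfl).symm (dexp_curve hG hs _ _ _ rfl rfl).symm ?_ d hd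
  have h32 : algebraMap ℚ (R.obj A) (3 / 2) = 3 * algebraMap ℚ (R.obj A) (1 / 2) := by
    rw [← map_ofNat (algebraMap ℚ (R.obj A)) 3, ← map_mul]
    norm_num
  have h2 := two_mul_algebraMap_half (R.obj A)
  rw [h₁, h₂, h₃, h32]
  set h := algebraMap ℚ (R.obj A) (1 / 2)
  simp only [sub_eq_add_neg, smul_add, smul_neg, smul_smul, Lie.add_bracket, Lie.bracket_add,
    Lie.smul_bracket, Lie.bracket_smul, Lie.neg_bracket, Lie.bracket_neg, Lie.bracket_swap Y₁ X₁,
    Lie.bracket_swap Y₂ X₁, Lie.bracket_swap Y₁ X₂]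
  -- coefficientwise, the two sides agree because of `2 h = 1` and `s³ = 0`
  match_scalars
  all_goals grind

theorem exp_cubic_zero (hG : G.IsRegular) (a b c : G.Lie A) : exp hG (cubic a b c 0) = 1 := by
  have h : cubic a b c 0 = (0 : R.obj A) • a := by simp [cubic]
  rw [h, exp_smul, flow_zero]

end SDG.LieGroup

/-- The third-order generalized Baker-Campbell-Hausdorff formula, at an arbitrary stage `A`. -/
theorem theorem4p3 {𝒮 : Type u} [Category.{v} 𝒮] (R : 𝒮 ⥤ CommAlgCat.{w} ℚ)
    (hR : SDG.KockLawvere R) (G : SDG.LieGroup.{u, v, w, w'} R) (hG : G.IsRegular) (A : 𝒮)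
    (d₁ d₂ d₃ : R.obj A) (hd₁ : d₁ ^ 2 = 0) (hd₂ : d₂ ^ 2 = 0) (hd₃ : d₃ ^ 2 = 0)
    (X₁ X₂ X₃ Y₁ Y₂ Y₃ : G.Lie A) (δ : R.obj A) (hδ : δ = d₁ + d₂ + d₃) :
    SDG.LieGroup.exp hG
        (δ • X₁ + ((1 / 2 : ℚ) • δ ^ 2) • X₂ + ((1 / 6 : ℚ) • δ ^ 3) • X₃) *
      SDG.LieGroup.exp hG
        (δ • Y₁ + ((1 / 2 : ℚ) • δ ^ 2) • Y₂ + ((1 / 6 : ℚ) • δ ^ 3) • Y₃) =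
    SDG.LieGroup.exp hG
      (δ • (X₁ + Y₁) + ((1 / 2 : ℚ) • δ ^ 2) • (X₂ + Y₂ + ⁅X₁, Y₁⁆) +
        ((1 / 6 : ℚ) • δ ^ 3) •
          ((X₃ + Y₃) + (algebraMap ℚ (R.obj A) (3 / 2)) • (⁅X₁, Y₂⁆ + ⁅X₂, Y₁⁆) +
            (algebraMap ℚ (R.obj A) (1 / 2)) • ⁅X₁ - Y₁, ⁅X₁, Y₁⁆⁆)) := by
  subst hδ
  -- start with the parameter `0` and add `d₁`, `d₂`, `d₃` in turn
  have h0 : (0 : R.obj A) ^ 3 = 0 := by simp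
  have h1 : (0 + d₁) ^ 3 = 0 := by linear_combination d₁ * hd₁
  have h2 : (0 + d₁ + d₂) ^ 3 = 0 := by
    linear_combination (d₁ + 3 * d₂) * hd₁ + (d₂ + 3 * d₁) * hd₂
  have key := SDG.LieGroup.exp_cubic_mul_add hG X₁ X₂ X₃ Y₁ Y₂ Y₃ h2 hd₃ rfl rfl rfl
    (SDG.LieGroup.exp_cubic_mul_add hG X₁ X₂ X₃ Y₁ Y₂ Y₃ h1 hd₂ rfl rfl rfl
      (SDG.LieGroup.exp_cubic_mul_add hG X₁ X₂ X₃ Y₁ Y₂ Y₃ h0 hd₁ rfl rfl rfl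
        (by simp only [SDG.LieGroup.exp_cubic_zero, mul_one])))
  rw [zero_add] at key
  exact key
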